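/- Permutations $\pi_1,\dots,\pi_r$ of $\{1,\dots,n\}$ are said to invariably generate the symmetric group $S_n$ if, whenever $\pi_i'$ is conjugate to $\pi_i$ in $S_n$ for each $i$ (with conjugating elements that may depend on $i$), the permutations $\pi_1',\dots,\pi_r'$ generate $S_n$. **Theorem.** If $\pi_1,\pi_2,\pi_3,\pi_4\in S_n$ are chosen independently and uniformly at random, then the probability that $\pi_1,\pi_2,\pi_3,\pi_4$ invariably generate $S_n$ is bounded away from zero. That is, there is an absolute constant $c>0$ such that for every $n$, $$\frac{\#\{(\pi_1,\pi_2,\pi_3,\pi_4)\in S_n^4 : \pi_1,\pi_2,\pi_3,\pi_4 \text{ invariably generate } S_n\}}{(n!)^4}\ \ge\ c .$$ -/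

import Mathlib

/-- A family `g` of elements of a group `G` invariably generates `G` if, however one replaces
each `g i` by a conjugate `g' i` of it (the conjugating elements may depend on `i`), the elements
`g' i` generate `G`. -/
def InvariablyGenerates {G : Type*} [Group G] {ι : Type*} (g : ι → G) : Prop :=
  ∀ g' : ι → G, (∀ i, IsConj (g i) (g' i)) → Subgroup.closure (Set.range g') = ⊤

/-- The probability of the event `E` for a uniformly random point of the finite type `Ω`. -/
noncomputable def uniformProb {Ω : Type*} [Finite Ω] (E : Set Ω) : ℝ :=
  (Nat.card E : ℝ) / (Nat.card Ω : ℝ)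

/-! Whether four permutations invariably generate depends only on their cycle types. Let `G` be
generated by conjugates of them. A `G`-invariant set of size `k` makes `k` a subset sum of the cycle
lengths of each one, so `G` is transitive as soon as no `0 < k < n` is a common subset sum. The same
condition gives primitivity if each permutation has a cycle of prime length `p ≤ n / 2` whose length
divides no other cycle length: some power of it is then a `p`-cycle, and every nontrivial block has
a translate preserved by the given generator (`exists_smul_block_eq`). A primitive group containing
such a `p`-cycle contains the alternating group, and one odd generator completes it
(`invariablyGenerates_of_cycleParts`).

Four permutations suffice because `4 * (1 - log 2) > 1`. Typically there are about `log k` cycles of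
length at most `k`, hence about `k ^ log 2` sums, so `k` should be a subset sum with probability
about `k ^ (log 2 - 1)`, whose fourth power is summable. The cutoff `18 / 25` lies between `log 2`
and `3 / 4`: too many short cycles are exponentially unlikely (`cycleProb_manyShort_le`), and
otherwise `k` is a subset sum with probability at most `8 * k ^ (-7 / 25)`
(`cycleProb_hasSubsetSum_le`). Hence for a large constant `K` a common sum in `(K, n / 2]` is
unlikely.

Sums up to `K` are excluded by making one permutation free of short cycles. Merging a short cycle
into another creates no new subset sum and costs a constant factor in probability
(`cycleProb_le_of_merge`); one further merge, in another permutation, corrects a sign. The prime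
cycles exist with probability tending to one, by Chebyshev's estimates. The finitely many remaining
`n` need only one invariably generating quadruple each. -/

open Finset

/-! ### The distribution of the cycle type -/

/-- The multisets of positive integers with sum `n`. -/
def partsFinset (n : ℕ) : Finset (Multiset ℕ) :=
  (univ : Finset n.Partition).image Nat.Partition.parts

theorem mem_partsFinset {n : ℕ} {m : Multiset ℕ} :
    m ∈ partsFinset n ↔ m.sum = n ∧ ∀ i ∈ m, 0 < i := by
  constructor
  · intro h
    obtain ⟨P, -, rfl⟩ := Finset.mem_image.1 h
    exact ⟨P.parts_sum, fun i hi => P.parts_pos hi⟩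
  · rintro ⟨h1, h2⟩
    exact Finset.mem_image.2 ⟨⟨m, fun {i} hi => h2 i hi, h1⟩, mem_univ _, rfl⟩

/-- The proportion of permutations whose multiset of cycle lengths is `m`. -/
noncomputable def cycleWeight (m : Multiset ℕ) : ℝ :=
  ((m.prod : ℝ) * ∏ k ∈ m.toFinset, ((m.count k).factorial : ℝ))⁻¹

theorem cycleWeight_nonneg (m : Multiset ℕ) : 0 ≤ cycleWeight m := by
  unfold cycleWeight; positivity

/-- The expectation of `h` at the multiset of cycle lengths of a uniform permutation of `n`
points. -/
noncomputable def cycleMean (n : ℕ) (h : Multiset ℕ → ℝ) : ℝ :=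
  ∑ m ∈ partsFinset n, cycleWeight m * h m

theorem cycleWeight_cons (j : ℕ) (m : Multiset ℕ) :
    ((j ::ₘ m).count j : ℝ) * cycleWeight (j ::ₘ m) = (j : ℝ)⁻¹ * cycleWeight m := by
  have hcnt : (∏ k ∈ (j ::ₘ m).toFinset, (((j ::ₘ m).count k).factorial : ℝ))
      = ((m.count j : ℝ) + 1) * ∏ k ∈ m.toFinset, ((m.count k).factorial : ℝ) := by
    have h1 : (∏ k ∈ m.toFinset, ((m.count k).factorial : ℝ))
        = ∏ k ∈ (j ::ₘ m).toFinset, ((m.count k).factorial : ℝ) := by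
      apply Finset.prod_subset
      · intro x hx; simp at hx ⊢; exact Or.inr hx
      · intro x _ hx
        have : m.count x = 0 := by simpa using hx
        simp [this]
    rw [h1]
    have hj : j ∈ (j ::ₘ m).toFinset := by simp
    rw [← Finset.mul_prod_erase _ _ hj, ← Finset.mul_prod_erase _ _ hj, ← mul_assoc]
    congr 1
    · rw [Multiset.count_cons_self, Nat.factorial_succ]; push_cast; ring
    · apply Finset.prod_congr rfl
      intro x hx
      rw [Multiset.count_cons_of_ne (Finset.ne_of_mem_erase hx)]
  unfold cycleWeight
  rw [hcnt, Multiset.prod_cons, Multiset.count_cons_self]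
  push_cast
  have : ((m.count j : ℝ) + 1) ≠ 0 := by positivity
  field_simp

/-- Deleting a cycle of length `j` leaves the cycle type of a uniform permutation of `n - j` points,
with weight `1 / j`; on weights this is `cycleWeight_cons`. All recursions, moments and merging
bounds below come from this identity. -/
theorem cycleMean_sum_erase (n : ℕ) (F : ℕ → Multiset ℕ → ℝ) :
    cycleMean n (fun m => (m.map fun l => F l (m.erase l)).sum)
      = ∑ j ∈ Icc 1 n, (j : ℝ)⁻¹ * cycleMean (n - j) (F j) := by
  unfold cycleMean
  have h1 : ∀ m : Multiset ℕ, cycleWeight m * (m.map fun l => F l (m.erase l)).sum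
      = ∑ l ∈ m.toFinset, (m.count l : ℝ) * cycleWeight m * F l (m.erase l) := by
    intro m
    rw [Finset.sum_multiset_map_count, Finset.mul_sum]
    refine Finset.sum_congr rfl fun l _ => ?_
    rw [nsmul_eq_mul]; ring
  simp_rw [h1, Finset.mul_sum]
  rw [Finset.sum_sigma', Finset.sum_sigma']
  refine Finset.sum_bij' (fun x _ => ⟨x.2, x.1.erase x.2⟩) (fun y _ => ⟨y.1 ::ₘ y.2, y.1⟩)
    ?_ ?_ ?_ ?_ ?_
  · rintro ⟨m, l⟩ h
    simp only [Finset.mem_sigma, mem_partsFinset, Multiset.mem_toFinset, Finset.mem_Icc] at h ⊢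
    obtain ⟨⟨h1, h2⟩, h3⟩ := h
    have h4 := Multiset.sum_erase h3
    refine ⟨⟨h2 l h3, by omega⟩, by omega, fun i hi => h2 i (Multiset.mem_of_mem_erase hi)⟩
  · rintro ⟨j, m⟩ h
    simp only [Finset.mem_sigma, mem_partsFinset, Multiset.mem_toFinset, Finset.mem_Icc] at h ⊢
    obtain ⟨⟨h1, h2⟩, h3, h4⟩ := h
    refine ⟨⟨by rw [Multiset.sum_cons]; omega, ?_⟩, by simp⟩
    intro i hi
    rcases Multiset.mem_cons.1 hi with rfl | hi
    · exact h1
    · exact h4 i hi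
  · rintro ⟨m, l⟩ h
    simp only [Finset.mem_sigma, Multiset.mem_toFinset] at h
    simp [Multiset.cons_erase h.2]
  · rintro ⟨j, m⟩ _
    simp
  · rintro ⟨m, l⟩ h
    simp only [Finset.mem_sigma, Multiset.mem_toFinset] at h
    have := cycleWeight_cons l (m.erase l)
    rw [Multiset.cons_erase h.2] at this
    dsimp only
    rw [this]; ring

theorem cycleMean_congr {n : ℕ} {g h : Multiset ℕ → ℝ}
    (H : ∀ m, m.sum = n → (∀ i ∈ m, 0 < i) → g m = h m) : cycleMean n g = cycleMean n h := by
  refine Finset.sum_congr rfl fun m hm => ?_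
  rw [mem_partsFinset] at hm
  rw [H m hm.1 hm.2]

theorem cycleMean_mono {n : ℕ} {g h : Multiset ℕ → ℝ}
    (H : ∀ m, m.sum = n → (∀ i ∈ m, 0 < i) → g m ≤ h m) : cycleMean n g ≤ cycleMean n h := by
  refine Finset.sum_le_sum fun m hm => ?_
  rw [mem_partsFinset] at hm
  exact mul_le_mul_of_nonneg_left (H m hm.1 hm.2) (cycleWeight_nonneg m)

theorem cycleMean_nonneg {n : ℕ} {h : Multiset ℕ → ℝ} (H : ∀ m, 0 ≤ h m) : 0 ≤ cycleMean n h :=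
  Finset.sum_nonneg fun m _ => mul_nonneg (cycleWeight_nonneg m) (H m)

theorem cycleMean_add (n : ℕ) (g h : Multiset ℕ → ℝ) :
    cycleMean n (fun m => g m + h m) = cycleMean n g + cycleMean n h := by
  simp [cycleMean, mul_add, Finset.sum_add_distrib]

theorem cycleMean_const_mul (n : ℕ) (c : ℝ) (h : Multiset ℕ → ℝ) :
    cycleMean n (fun m => c * h m) = c * cycleMean n h := by
  unfold cycleMean
  rw [Finset.mul_sum]
  exact Finset.sum_congr rfl fun m _ => by ring

theorem cycleMean_mul_const (n : ℕ) (c : ℝ) (h : Multiset ℕ → ℝ) :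
    cycleMean n (fun m => h m * c) = cycleMean n h * c := by
  simp_rw [mul_comm _ c]; exact cycleMean_const_mul n c h

theorem cycleMean_sum {ι : Type*} (n : ℕ) (s : Finset ι) (h : ι → Multiset ℕ → ℝ) :
    cycleMean n (fun m => ∑ i ∈ s, h i m) = ∑ i ∈ s, cycleMean n (h i) := by
  unfold cycleMean
  rw [Finset.sum_comm]
  exact Finset.sum_congr rfl fun m _ => by rw [Finset.mul_sum]

theorem cycleMean_comm (n k : ℕ) (h : Multiset ℕ → Multiset ℕ → ℝ) :
    cycleMean n (fun m => cycleMean k fun m' => h m m')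
      = cycleMean k fun m' => cycleMean n fun m => h m m' := by
  unfold cycleMean
  simp_rw [Finset.mul_sum]
  rw [Finset.sum_comm]
  exact Finset.sum_congr rfl fun _ _ => Finset.sum_congr rfl fun _ _ => by ring

theorem partsFinset_zero : partsFinset 0 = {0} := by
  ext m
  rw [mem_partsFinset, Finset.mem_singleton]
  constructor
  · rintro ⟨h1, h2⟩
    by_contra h
    obtain ⟨i, hi⟩ := Multiset.exists_mem_of_ne_zero h
    have := h2 i hi
    have := Multiset.le_sum_of_mem hi
    omega
  · rintro rfl; simp

theorem cycleMean_zero (h : Multiset ℕ → ℝ) : cycleMean 0 h = h 0 := by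
  simp [cycleMean, partsFinset_zero, cycleWeight]

/-- The weight `l` on a deleted cycle cancels `1 / l`: the cycle through a given point has uniformly
distributed length. -/
theorem mul_cycleMean (n : ℕ) (h : Multiset ℕ → ℝ) :
    n * cycleMean n h = ∑ j ∈ Icc 1 n, cycleMean (n - j) fun m => h (j ::ₘ m) := by
  have := cycleMean_sum_erase n fun l m => l * h (l ::ₘ m)
  rw [← cycleMean_const_mul]
  convert this using 1
  · refine cycleMean_congr fun m hm _ => ?_
    have : (m.map fun l : ℕ => (l : ℝ) * h (l ::ₘ m.erase l))
        = m.map fun l : ℕ => (l : ℝ) * h m := by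
      refine Multiset.map_congr rfl fun l hl => ?_
      rw [Multiset.cons_erase hl]
    rw [this, Multiset.sum_map_mul_right, ← hm]
    congr 1
    exact map_multiset_sum (Nat.castRingHom ℝ) m
  · refine Finset.sum_congr rfl fun j hj => ?_
    have : (j : ℝ) ≠ 0 := by
      have := (Finset.mem_Icc.1 hj).1
      positivity
    rw [cycleMean_const_mul]; field_simp

theorem cycleMean_one (n : ℕ) : cycleMean n (fun _ => 1) = 1 := by
  induction n using Nat.strong_induction_on with
  | _ n ih =>
    rcases Nat.eq_zero_or_pos n with rfl | hn
    · exact cycleMean_zero _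
    · have h := mul_cycleMean n fun _ => 1
      have h2 : ∑ j ∈ Icc 1 n, cycleMean (n - j) (fun _ => 1) = ∑ j ∈ Icc 1 n, (1 : ℝ) := by
        refine Finset.sum_congr rfl fun j hj => ih _ ?_
        have := Finset.mem_Icc.1 hj
        omega
      rw [h2] at h
      have hn' : (n : ℝ) ≠ 0 := by positivity
      exact mul_left_cancel₀ hn' (by rw [h]; simp)

theorem cycleMean_const (n : ℕ) (c : ℝ) : cycleMean n (fun _ => c) = c := by
  have := cycleMean_const_mul n c fun _ => 1
  simpa [cycleMean_one] using this

/-! ### From permutations to cycle types -/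

/-- The multiset of all cycle lengths of a permutation, fixed points counting as cycles of
length one. -/
def cycleParts {α : Type*} [Fintype α] [DecidableEq α] (σ : Equiv.Perm α) : Multiset ℕ :=
  σ.cycleType + Multiset.replicate (Fintype.card α - #σ.support) 1

theorem card_cycleParts_eq {α : Type*} [Fintype α] [DecidableEq α] {m : Multiset ℕ}
    (hs : m.sum = Fintype.card α) (hp : ∀ i ∈ m, 0 < i) :
    (#{σ : Equiv.Perm α | cycleParts σ = m} : ℝ) = (Fintype.card α).factorial * cycleWeight m := by
  set c := m.filter (2 ≤ ·) with hc
  have hsplit : m = c + Multiset.replicate (m.count 1) 1 := by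
    conv_lhs => rw [← Multiset.filter_add_not (2 ≤ ·) m]
    rw [← Multiset.filter_eq' m 1]
    congr 1
    refine Multiset.filter_congr fun i hi => ?_
    have := hp i hi
    omega
  have hsum : c.sum + m.count 1 = Fintype.card α := by
    rw [← hs]; conv_rhs => rw [hsplit]
    simp
  have hiff : ∀ σ : Equiv.Perm α, cycleParts σ = m ↔ σ.cycleType = c := by
    intro σ
    constructor
    · intro h
      rw [hc, ← h, cycleParts, Multiset.filter_add, Multiset.filter_eq_self.2
        fun _ => Equiv.Perm.two_le_of_mem_cycleType, Multiset.filter_eq_nil.2, add_zero]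
      intro a ha
      rw [Multiset.eq_of_mem_replicate ha]; decide
    · intro h
      have h2 := σ.sum_cycleType
      rw [cycleParts, h, ← h2, h]
      conv_rhs => rw [hsplit]
      congr 2; omega
  have key := Equiv.Perm.card_of_cycleType_mul_eq α c
  rw [if_pos ⟨by omega, fun a ha => (Multiset.mem_filter.1 ha).2⟩] at key
  have hfil : ({σ : Equiv.Perm α | cycleParts σ = m} : Finset _)
      = ({σ : Equiv.Perm α | σ.cycleType = c} : Finset _) := by
    ext σ; simp [hiff]
  rw [hfil, cycleWeight]
  have hprod : m.prod = c.prod := by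
    conv_lhs => rw [hsplit]
    simp
  have hsub : Fintype.card α - c.sum = m.count 1 := by omega
  have hfac : ∏ k ∈ m.toFinset, (m.count k).factorial
      = (m.count 1).factorial * ∏ k ∈ c.toFinset, (c.count k).factorial := by
    have h1 : ∏ k ∈ m.toFinset, (m.count k).factorial
        = ∏ k ∈ insert 1 c.toFinset, (m.count k).factorial := by
      refine Finset.prod_subset ?_ ?_
      · intro x hx
        have hx' := Multiset.mem_toFinset.1 hx
        have := hp x hx'
        simp [hc, hx']
        omega
      · intro x _ hx
        have : m.count x = 0 := by simpa using hx
        simp [this]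
    rw [h1, Finset.prod_insert (by simp [hc])]
    congr 1
    refine Finset.prod_congr rfl fun x hx => ?_
    have hx' := (Multiset.mem_filter.1 (Multiset.mem_toFinset.1 hx)).2
    rw [hc, Multiset.count_filter_of_pos hx']
  rw [hsub] at key
  have hpos : (0 : ℝ) < (m.prod : ℝ) * ∏ k ∈ m.toFinset, ((m.count k).factorial : ℝ) := by
    have : 0 < m.prod := Multiset.prod_pos hp
    have : (0 : ℝ) < m.prod := by exact_mod_cast this
    positivity
  rw [eq_mul_inv_iff_mul_eq₀ hpos.ne']
  rw [← key, hprod]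
  have hfac' := congrArg (Nat.cast : ℕ → ℝ) hfac
  push_cast at hfac' ⊢
  rw [hfac']; ring

theorem sum_cycleParts {α : Type*} [Fintype α] [DecidableEq α] (σ : Equiv.Perm α) :
    (cycleParts σ).sum = Fintype.card α :=
  σ.partition.parts_sum

theorem pos_of_mem_cycleParts {α : Type*} [Fintype α] [DecidableEq α] {σ : Equiv.Perm α} {i : ℕ}
    (hi : i ∈ cycleParts σ) : 0 < i :=
  σ.partition.parts_pos hi

theorem sum_perm_eq_cycleMean (n : ℕ) (h : Multiset ℕ → ℝ) :
    ∑ σ : Equiv.Perm (Fin n), h (cycleParts σ) = n.factorial * cycleMean n h := by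
  rw [← Finset.sum_fiberwise_of_maps_to (s := univ) (t := partsFinset n)
    (g := fun σ : Equiv.Perm (Fin n) => cycleParts σ)]
  · unfold cycleMean
    rw [Finset.mul_sum]
    refine Finset.sum_congr rfl fun m hm => ?_
    rw [mem_partsFinset] at hm
    have := card_cycleParts_eq (α := Fin n) (m := m) (by simpa using hm.1) hm.2
    rw [Finset.sum_congr rfl (g := fun _ => h m)]
    · rw [Finset.sum_const, nsmul_eq_mul, this]; simp; ring
    · intro σ hσ
      rw [(Finset.mem_filter.1 hσ).2]
  · intro σ _
    rw [mem_partsFinset]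
    exact ⟨by simpa using sum_cycleParts σ, fun i hi => pos_of_mem_cycleParts hi⟩

/-! ### Multiplicative functions of the cycle lengths -/

theorem mul_cycleMean_prod (n : ℕ) (a : ℕ → ℝ) :
    n * cycleMean n (fun m => (m.map a).prod)
      = ∑ j ∈ Icc 1 n, a j * cycleMean (n - j) fun m => (m.map a).prod := by
  rw [mul_cycleMean]
  refine Finset.sum_congr rfl fun j _ => ?_
  simp_rw [Multiset.map_cons, Multiset.prod_cons]
  exact cycleMean_const_mul _ _ _

/-- The number of submultisets of `m` with sum `k`. -/
def subsetSumCount (k : ℕ) (m : Multiset ℕ) : ℕ := (m.powerset.map Multiset.sum).count k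

theorem subsetSumCount_cons (k j : ℕ) (m : Multiset ℕ) :
    subsetSumCount k (j ::ₘ m)
      = subsetSumCount k m + if j ≤ k then subsetSumCount (k - j) m else 0 := by
  unfold subsetSumCount
  rw [Multiset.powerset_cons, Multiset.map_add, Multiset.count_add]
  congr 1
  rw [Multiset.map_map]
  have : (Multiset.map (Multiset.sum ∘ Multiset.cons j) m.powerset)
      = (m.powerset.map Multiset.sum).map (j + ·) := by
    rw [Multiset.map_map]; simp
  rw [this]
  split_ifs with h
  · obtain ⟨i, rfl⟩ := Nat.exists_eq_add_of_le h
    rw [Nat.add_sub_cancel_left]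
    exact Multiset.count_map_eq_count' _ _ (add_right_injective j) i
  · rw [Multiset.count_eq_zero]
    intro hk
    obtain ⟨i, -, hi⟩ := Multiset.mem_map.1 hk
    omega

theorem subsetSumCount_pos_iff {k : ℕ} {m : Multiset ℕ} :
    0 < subsetSumCount k m ↔ ∃ s ≤ m, s.sum = k := by
  simp [subsetSumCount, Multiset.count_pos]

/-- An invariant set of size `k` splits a permutation into independent uniform permutations of `k`
and `n - k` points, and a multiplicative weight factors along the split. In the induction the
deleted cycle lies either inside or outside the chosen submultiset. -/
theorem cycleMean_subsetSumCount_mul_prod (a : ℕ → ℝ) (n k : ℕ) :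
    cycleMean n (fun m => subsetSumCount k m * (m.map a).prod)
      = if k ≤ n then cycleMean k (fun m => (m.map a).prod)
          * cycleMean (n - k) (fun m => (m.map a).prod) else 0 := by
  induction n using Nat.strong_induction_on generalizing k with
  | _ n ih =>
    rcases Nat.eq_zero_or_pos n with rfl | hn
    · rw [cycleMean_zero]
      rcases Nat.eq_zero_or_pos k with rfl | hk
      · simp [cycleMean_zero, subsetSumCount]
      · simp [subsetSumCount, hk.ne']
    have hn' : (n : ℝ) ≠ 0 := by positivity
    apply mul_left_cancel₀ hn'
    rw [mul_cycleMean]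
    set A : ℕ → ℝ := fun n => cycleMean n fun m => (m.map a).prod with hA
    have hstep : ∀ j ∈ Icc 1 n, cycleMean (n - j)
          (fun m => (subsetSumCount k (j ::ₘ m) : ℝ) * ((j ::ₘ m).map a).prod)
        = (if j ≤ n - k ∧ k ≤ n then a j * A (n - k - j) * A k else 0)
          + if j ≤ k ∧ k ≤ n then a j * A (k - j) * A (n - k) else 0 := by
      intro j hj
      have hj' := Finset.mem_Icc.1 hj
      have e1 : ∀ m : Multiset ℕ, (subsetSumCount k (j ::ₘ m) : ℝ) * ((j ::ₘ m).map a).prod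
          = a j * (subsetSumCount k m * (m.map a).prod)
            + (if j ≤ k then a j else 0) * (subsetSumCount (k - j) m * (m.map a).prod) := by
        intro m
        rw [subsetSumCount_cons, Multiset.map_cons, Multiset.prod_cons]
        split_ifs <;> push_cast <;> ring
      simp_rw [e1]
      rw [cycleMean_add, cycleMean_const_mul, cycleMean_const_mul, ih _ (by omega),
        ih _ (by omega)]
      congr 1
      · by_cases h : k ≤ n - j
        · rw [if_pos h, if_pos (by omega), show n - j - k = n - k - j by omega]; ring
        · rw [if_neg h, if_neg (by omega), mul_zero]
      · by_cases h : j ≤ k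
        · by_cases h2 : k ≤ n
          · rw [if_pos h, if_pos (by omega), if_pos ⟨h, h2⟩,
              show n - j - (k - j) = n - k by omega]; ring
          · rw [if_pos h, if_neg (by omega), if_neg (by omega), mul_zero]
        · rw [if_neg h, zero_mul, if_neg fun h' => h h'.1]
    rw [Finset.sum_congr rfl hstep, Finset.sum_add_distrib]
    by_cases hkn : k ≤ n
    · rw [if_pos hkn]
      have r1 : ∑ j ∈ Icc 1 n, (if j ≤ n - k ∧ k ≤ n then a j * A (n - k - j) * A k else 0)
          = ((n - k : ℕ) : ℝ) * A (n - k) * A k := by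
        rw [hA]; dsimp only
        rw [mul_cycleMean_prod, Finset.sum_mul, ← Finset.sum_filter]
        refine Finset.sum_congr ?_ fun _ _ => rfl
        ext j; simp only [Finset.mem_filter, Finset.mem_Icc]; omega
      have r2 : ∑ j ∈ Icc 1 n, (if j ≤ k ∧ k ≤ n then a j * A (k - j) * A (n - k) else 0)
          = (k : ℝ) * A k * A (n - k) := by
        rw [hA]; dsimp only
        rw [mul_cycleMean_prod, Finset.sum_mul, ← Finset.sum_filter]
        refine Finset.sum_congr ?_ fun _ _ => rfl
        ext j; simp only [Finset.mem_filter, Finset.mem_Icc]; omega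
      rw [r1, r2, Nat.cast_sub hkn]; ring
    · rw [if_neg hkn, mul_zero]
      simp [hkn]

/-! ### The weight giving one half to each short cycle -/

/-- The expectation of `2 ^ (-N)`, where `N` is the number of cycles of length at most `k`. -/
noncomputable def halfMean (k n : ℕ) : ℝ :=
  cycleMean n fun m => (m.map fun l => if l ≤ k then (1 / 2 : ℝ) else 1).prod

theorem halfMean_nonneg (k n : ℕ) : 0 ≤ halfMean k n := by
  refine cycleMean_nonneg fun m => Multiset.prod_nonneg fun x hx => ?_
  obtain ⟨l, -, rfl⟩ := Multiset.mem_map.1 hx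
  split_ifs <;> norm_num

theorem halfMean_zero (k : ℕ) : halfMean k 0 = 1 := by simp [halfMean, cycleMean_zero]

theorem sum_Icc_sub_eq_sum_range (n : ℕ) (f : ℕ → ℝ) :
    ∑ j ∈ Icc 1 n, f (n - j) = ∑ i ∈ range n, f i := by
  rw [← Finset.sum_range_reflect, ← Finset.Ico_add_one_right_eq_Icc, Finset.sum_Ico_eq_sum_range]
  refine Finset.sum_congr (by simp) fun i _ => ?_
  congr 1; omega

theorem mul_halfMean_of_le {k n : ℕ} (h : n ≤ k) :
    n * halfMean k n = 1 / 2 * ∑ i ∈ range n, halfMean k i := by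
  unfold halfMean
  rw [mul_cycleMean_prod, ← sum_Icc_sub_eq_sum_range, Finset.mul_sum]
  refine Finset.sum_congr rfl fun j hj => ?_
  rw [if_pos ((Finset.mem_Icc.1 hj).2.trans h)]

theorem mul_halfMean_le (k n : ℕ) :
    n * halfMean k n ≤ ∑ i ∈ range n, halfMean k i := by
  rw [← sum_Icc_sub_eq_sum_range]
  unfold halfMean
  rw [mul_cycleMean_prod]
  refine Finset.sum_le_sum fun j hj => ?_
  have := halfMean_nonneg k (n - j)
  unfold halfMean at this
  split_ifs <;> linarith

theorem sum_inv_sqrt_le (n : ℕ) :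
    ∑ i ∈ range n, (if i = 0 then (1 : ℝ) else 1 / √i) ≤ 2 * √n := by
  -- The bound with `n + 1` under the root, one less than the number of terms, is an equality at `n
  -- = 0` and is what the induction propagates.
  have key : ∀ n : ℕ, ∑ i ∈ range (n + 2), (if i = 0 then (1 : ℝ) else 1 / √i)
      ≤ 2 * √((n : ℝ) + 1) := by
    intro n
    induction n with
    | zero => norm_num [Finset.sum_range_succ]
    | succ n ih =>
      rw [Finset.sum_range_succ, if_neg (by omega)]
      have ha : (0 : ℝ) < (n : ℝ) + 1 := by positivity
      have h1 := Real.mul_self_sqrt ha.le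
      have h2 := Real.mul_self_sqrt (show (0 : ℝ) ≤ (n : ℝ) + 1 + 1 by positivity)
      have h3 : 0 < √((n : ℝ) + 1 + 1) := Real.sqrt_pos.2 (by positivity)
      have e : ((n + 2 : ℕ) : ℝ) = (n : ℝ) + 1 + 1 := by push_cast; ring
      have h4 : 1 / √((n : ℝ) + 1 + 1) ≤ 2 * √((n : ℝ) + 1 + 1) - 2 * √((n : ℝ) + 1) := by
        rw [div_le_iff₀ h3]
        nlinarith [sq_nonneg (√((n : ℝ) + 1 + 1) - √((n : ℝ) + 1))]
      rw [e]; push_cast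
      linarith
  rcases n with _ | _ | n
  · simp
  · simp
  · refine (key n).trans ?_
    gcongr
    push_cast; linarith

/-- For `n ≤ k` every cycle has weight one half, so these are the coefficients of `(1 - x) ^ (-1 /
2)`, of order `n ^ (-1 / 2)`. -/
theorem halfMean_le_of_le {k n : ℕ} (hn : n ≤ k) :
    halfMean k n ≤ if n = 0 then 1 else 1 / √n := by
  induction n using Nat.strong_induction_on with
  | _ n ih =>
    split_ifs with h0
    · rw [h0, halfMean_zero]
    have hpos : (0 : ℝ) < n := by exact_mod_cast Nat.pos_of_ne_zero h0
    have h1 := mul_halfMean_of_le hn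
    have h2 : ∑ i ∈ range n, halfMean k i ≤ 2 * √n :=
      (Finset.sum_le_sum fun i hi => ih i (Finset.mem_range.1 hi)
        ((Finset.mem_range.1 hi).le.trans hn)).trans (sum_inv_sqrt_le n)
    have h3 : 0 < √(n : ℝ) := Real.sqrt_pos.2 hpos
    have h4 : √(n : ℝ) * √n = n := Real.mul_self_sqrt hpos.le
    rw [le_div_iff₀ h3]
    nlinarith

/-- Beyond `k` each value is at most the average of all earlier ones. The first `k` values sum to at
most `2 * √k`, below the `k * (4 / √k) = 4 * √k` that the induction allows. -/
theorem halfMean_le {k n : ℕ} (hk : 0 < k) (hn : k ≤ n) : halfMean k n ≤ 4 / √k := by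
  have hk' : (0 : ℝ) < k := by exact_mod_cast hk
  have hs : 0 < √(k : ℝ) := Real.sqrt_pos.2 hk'
  have hsq : √(k : ℝ) * √k = k := Real.mul_self_sqrt hk'.le
  have hsum : ∑ i ∈ range k, halfMean k i ≤ 2 * √k :=
    (Finset.sum_le_sum fun i hi => halfMean_le_of_le (Finset.mem_range.1 hi).le).trans
      (sum_inv_sqrt_le k)
  induction n using Nat.strong_induction_on with
  | _ n ih =>
    have hpos : (0 : ℝ) < n := by exact_mod_cast hk.trans_le hn
    have h1 := mul_halfMean_le k n
    rw [← Finset.sum_range_add_sum_Ico _ hn] at h1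
    have h2 : ∑ i ∈ Ico k n, halfMean k i ≤ ∑ i ∈ Ico k n, 4 / √(k : ℝ) :=
      Finset.sum_le_sum fun i hi =>
        ih i (Finset.mem_Ico.1 hi).2 (Finset.mem_Ico.1 hi).1
    rw [Finset.sum_const, Nat.card_Ico, nsmul_eq_mul, Nat.cast_sub hn] at h2
    have h3 : (k : ℝ) * (4 / √k) = 4 * √k := by
      rw [mul_div_assoc', div_eq_iff hs.ne', mul_assoc, hsq]; ring
    have h4 : (n : ℝ) * halfMean k n ≤ n * (4 / √k) := by nlinarith
    exact le_of_mul_le_mul_left h4 hpos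

/-! ### Counting cycles with prescribed lengths -/

/-- The sum of the reciprocals of the integers in `[1, n]` satisfying `q`. -/
noncomputable def invSum (q : ℕ → Prop) [DecidablePred q] (n : ℕ) : ℝ :=
  ∑ j ∈ Icc 1 n with q j, (j : ℝ)⁻¹

theorem invSum_nonneg (q : ℕ → Prop) [DecidablePred q] (n : ℕ) : 0 ≤ invSum q n :=
  Finset.sum_nonneg fun _ _ => by positivity

theorem invSum_mono (q : ℕ → Prop) [DecidablePred q] {k n : ℕ} (h : k ≤ n) :
    invSum q k ≤ invSum q n :=
  Finset.sum_le_sum_of_subset_of_nonneg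
    (Finset.filter_subset_filter _ (Finset.Icc_subset_Icc_right h)) fun _ _ _ => by positivity

theorem sum_map_ite_const (q : ℕ → Prop) [DecidablePred q] (m : Multiset ℕ) (c : ℝ) :
    (m.map fun l => if q l then c else 0).sum = m.countP q * c := by
  induction m using Multiset.induction with
  | empty => simp
  | cons a s ih =>
    rw [Multiset.map_cons, Multiset.sum_cons, ih, Multiset.countP_cons]
    split_ifs
    · push_cast; ring
    · simp

theorem sum_map_ite_erase (q : ℕ → Prop) [DecidablePred q] (m : Multiset ℕ) (r : ℕ) :
    (m.map fun l => if q l then (((m.erase l).countP q).choose r : ℝ) else 0).sum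
      = (r + 1) * ((m.countP q).choose (r + 1) : ℝ) := by
  have h1 : (m.map fun l => if q l then (((m.erase l).countP q).choose r : ℝ) else 0)
      = m.map fun l => if q l then ((m.countP q - 1).choose r : ℝ) else 0 := by
    refine Multiset.map_congr rfl fun l hl => ?_
    split_ifs with h
    · have : m.countP q = (m.erase l).countP q + 1 := by
        conv_lhs => rw [← Multiset.cons_erase hl, Multiset.countP_cons_of_pos _ h]
      rw [this, Nat.add_sub_cancel]
    · rfl
  rw [h1]
  rw [sum_map_ite_const]
  rcases Nat.eq_zero_or_pos (m.countP q) with h | h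
  · simp [h]
  · obtain ⟨c, hc⟩ := Nat.exists_eq_add_of_lt h
    rw [hc]
    have := Nat.add_one_mul_choose_eq c r
    simp only [zero_add, Nat.add_sub_cancel]
    exact_mod_cast by rw [this]; ring

theorem mul_cycleMean_choose_countP (q : ℕ → Prop) [DecidablePred q] (n r : ℕ) :
    (r + 1) * cycleMean n (fun m => ((m.countP q).choose (r + 1) : ℝ))
      = ∑ j ∈ Icc 1 n with q j,
          (j : ℝ)⁻¹ * cycleMean (n - j) fun m => ((m.countP q).choose r : ℝ) := by
  have h := cycleMean_sum_erase n fun l m => if q l then ((m.countP q).choose r : ℝ) else 0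
  simp_rw [sum_map_ite_erase] at h
  rw [← cycleMean_const_mul, h, Finset.sum_filter]
  refine Finset.sum_congr rfl fun j _ => ?_
  split_ifs
  · rfl
  · rw [cycleMean_const, mul_zero]

theorem cycleMean_countP (q : ℕ → Prop) [DecidablePred q] (n : ℕ) :
    cycleMean n (fun m => (m.countP q : ℝ)) = invSum q n := by
  have := mul_cycleMean_choose_countP q n 0
  simpa [cycleMean_one, invSum] using this

/-- The factorial moments of the count are dominated by those of a Poisson variable of mean `invSum
q N`. The bound is uniform over `n ≤ N`, as the recursion passes to smaller `n`. -/
theorem cycleMean_choose_countP_le (q : ℕ → Prop) [DecidablePred q] {n N : ℕ} (h : n ≤ N)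
    (r : ℕ) :
    cycleMean n (fun m => ((m.countP q).choose r : ℝ)) ≤ invSum q N ^ r / r.factorial := by
  induction r generalizing n with
  | zero => simp [cycleMean_one]
  | succ r ih =>
    have h1 := mul_cycleMean_choose_countP q n r
    have h2 : ∑ j ∈ Icc 1 n with q j,
          (j : ℝ)⁻¹ * cycleMean (n - j) (fun m => ((m.countP q).choose r : ℝ))
        ≤ ∑ j ∈ Icc 1 n with q j, (j : ℝ)⁻¹ * (invSum q N ^ r / r.factorial) :=
      Finset.sum_le_sum fun j _ =>
        mul_le_mul_of_nonneg_left (ih ((Nat.sub_le _ _).trans h)) (by positivity)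
    rw [← Finset.sum_mul] at h2
    have h3 : (∑ j ∈ Icc 1 n with q j, (j : ℝ)⁻¹) ≤ invSum q N := invSum_mono q h
    have h4 : 0 ≤ invSum q N ^ r / r.factorial :=
      div_nonneg (pow_nonneg (invSum_nonneg q N) _) (by positivity)
    have h5 := h2.trans (mul_le_mul_of_nonneg_right h3 h4)
    rw [← h1] at h5
    have h6 : invSum q N ^ (r + 1) / (r + 1).factorial
        = (invSum q N * (invSum q N ^ r / r.factorial)) / (r + 1) := by
      rw [Nat.factorial_succ, pow_succ]
      push_cast
      field_simp
    rw [h6, le_div_iff₀ (by positivity)]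
    linarith

theorem cycleMean_pow_countP_le (q : ℕ → Prop) [DecidablePred q] (n : ℕ) {y : ℝ} (hy : 0 ≤ y) :
    cycleMean n (fun m => (1 + y) ^ m.countP q) ≤ Real.exp (y * invSum q n) := by
  have h1 : cycleMean n (fun m => (1 + y) ^ m.countP q)
      = ∑ r ∈ range (n + 1), y ^ r * cycleMean n fun m => ((m.countP q).choose r : ℝ) := by
    simp_rw [← cycleMean_const_mul]
    rw [← cycleMean_sum]
    refine cycleMean_congr fun m hm hpos => ?_
    have hc : m.countP q ≤ n := by
      refine (Multiset.countP_le_card _ _).trans ?_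
      rw [← hm]
      have := Multiset.card_nsmul_le_sum (s := m) (a := 1) fun i hi => hpos i hi
      simpa using this
    rw [add_comm 1 y, add_pow]
    simp only [one_pow, mul_one]
    refine Finset.sum_subset (Finset.range_mono (by omega)) fun r _ hr => ?_
    rw [Nat.choose_eq_zero_of_lt (by simpa using hr)]
    simp
  rw [h1]
  refine le_trans ?_ (Real.sum_le_exp_of_nonneg (mul_nonneg hy (invSum_nonneg q n)) (n + 1))
  refine Finset.sum_le_sum fun r _ => ?_
  rw [mul_pow, mul_div_assoc]
  exact mul_le_mul_of_nonneg_left (cycleMean_choose_countP_le q le_rfl r) (by positivity)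

theorem invSum_le (k n : ℕ) : invSum (· ≤ k) n ≤ 1 + Real.log k := by
  have h := harmonic_le_one_add_log k
  refine le_trans ?_ h
  rw [harmonic_eq_sum_Icc]
  push_cast
  refine Finset.sum_le_sum_of_subset_of_nonneg (fun j hj => ?_) fun _ _ _ => by positivity
  simp only [Finset.mem_filter, Finset.mem_Icc] at hj ⊢
  omega

/-! ### Probabilities -/

open Classical in
/-- The probability that the multiset of cycle lengths of a uniform permutation of `n` points
satisfies `Q`. -/
noncomputable def cycleProb (n : ℕ) (Q : Multiset ℕ → Prop) : ℝ :=
  cycleMean n fun m => if Q m then 1 else 0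

theorem cycleProb_nonneg (n : ℕ) (Q : Multiset ℕ → Prop) : 0 ≤ cycleProb n Q :=
  cycleMean_nonneg fun m => by split_ifs <;> norm_num

theorem cycleProb_le_cycleMean {n : ℕ} {Q : Multiset ℕ → Prop} {h : Multiset ℕ → ℝ}
    (h0 : ∀ m, 0 ≤ h m) (h1 : ∀ m, m.sum = n → (∀ i ∈ m, 0 < i) → Q m → 1 ≤ h m) :
    cycleProb n Q ≤ cycleMean n h := by
  refine cycleMean_mono fun m hm hp => ?_
  split_ifs with hQ
  · exact h1 m hm hp hQ
  · exact h0 m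

theorem cycleProb_mono {n : ℕ} {Q R : Multiset ℕ → Prop}
    (H : ∀ m, m.sum = n → (∀ i ∈ m, 0 < i) → Q m → R m) : cycleProb n Q ≤ cycleProb n R :=
  cycleProb_le_cycleMean (fun m => by split_ifs <;> norm_num) fun m hm hp hQ => by
    rw [if_pos (H m hm hp hQ)]

theorem cycleProb_or_le (n : ℕ) (Q R : Multiset ℕ → Prop) :
    cycleProb n (fun m => Q m ∨ R m) ≤ cycleProb n Q + cycleProb n R := by
  unfold cycleProb
  rw [← cycleMean_add]
  refine cycleMean_mono fun m _ _ => ?_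
  by_cases h1 : Q m <;> by_cases h2 : R m <;> simp [h1, h2]

theorem cycleProb_not (n : ℕ) (Q : Multiset ℕ → Prop) :
    cycleProb n (fun m => ¬ Q m) = 1 - cycleProb n Q := by
  rw [eq_sub_iff_add_eq, ← cycleMean_one n, cycleProb, cycleProb, ← cycleMean_add]
  refine cycleMean_congr fun m _ _ => ?_
  by_cases h : Q m <;> simp [h]

theorem cycleProb_lt_countP_le (q : ℕ → Prop) [DecidablePred q] (n R : ℕ) :
    cycleProb n (fun m => R < m.countP q) ≤ invSum q n / (R + 1) := by
  rw [← cycleMean_countP, div_eq_mul_inv, ← cycleMean_mul_const]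
  refine cycleProb_le_cycleMean (fun m => by positivity) fun m _ _ hQ => ?_
  rw [← div_eq_mul_inv, le_div_iff₀ (by positivity), one_mul]
  exact_mod_cast hQ

theorem prod_map_ite_half (k : ℕ) (m : Multiset ℕ) :
    (m.map fun l => if l ≤ k then (1 / 2 : ℝ) else 1).prod = (1 / 2) ^ m.countP (· ≤ k) := by
  induction m using Multiset.induction with
  | empty => simp
  | cons a s ih =>
    rw [Multiset.map_cons, Multiset.prod_cons, ih, Multiset.countP_cons]
    split_ifs
    · rw [pow_succ]; ring
    · simp

theorem cycleProb_forall_lt_le {k n : ℕ} (hk : 0 < k) (hn : k ≤ n) :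
    cycleProb n (fun m => ∀ l ∈ m, k < l) ≤ 4 / √k := by
  refine le_trans (cycleProb_le_cycleMean (fun m => ?_) fun m _ _ hQ => ?_) (halfMean_le hk hn)
  · rw [prod_map_ite_half]; positivity
  · rw [prod_map_ite_half, Multiset.countP_eq_zero.2 fun l hl => not_le.2 (hQ l hl)]
    simp

/-! ### Merging two cycles -/

/-- Deleting `s` costs `1 / s`, while the weight `l` cancels the cost of deleting `l`. For fixed `s`
the merged length `l + s` runs injectively through part of `[1, n]`, so `mul_cycleMean` bounds the
inner sum by `n` times the mean of `h`. -/
theorem cycleMean_merge_le (n K : ℕ) {h : Multiset ℕ → ℝ} (h0 : ∀ m, 0 ≤ h m) :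
    cycleMean n (fun m => (m.map fun s => if s ≤ K then
        ((m.erase s).map fun l : ℕ => (l : ℝ) * h ((l + s) ::ₘ (m.erase s).erase l)).sum else 0).sum)
      ≤ n * invSum (· ≤ K) n * cycleMean n h := by
  rw [cycleMean_sum_erase n fun s m => if s ≤ K then
        (m.map fun l : ℕ => (l : ℝ) * h ((l + s) ::ₘ m.erase l)).sum else 0]
  rw [mul_comm (n : ℝ), mul_assoc, invSum, Finset.sum_mul, Finset.sum_filter]
  refine Finset.sum_le_sum fun s hs => ?_
  have hs' := Finset.mem_Icc.1 hs
  split_ifs with hK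
  · refine mul_le_mul_of_nonneg_left ?_ (by positivity)
    rw [cycleMean_sum_erase (n - s) fun (l : ℕ) m => (l : ℝ) * h ((l + s) ::ₘ m), mul_cycleMean]
    have e : ∀ l ∈ Icc 1 (n - s), (l : ℝ)⁻¹ * cycleMean (n - s - l)
        (fun m => (l : ℝ) * h ((l + s) ::ₘ m))
        = cycleMean (n - (l + s)) fun m => h ((l + s) ::ₘ m) := by
      intro l hl
      have hl' := Finset.mem_Icc.1 hl
      have : (l : ℝ) ≠ 0 := by
        have : 0 < l := hl'.1
        positivity
      rw [cycleMean_const_mul, inv_mul_cancel_left₀ this, show n - s - l = n - (l + s) by omega]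
    rw [Finset.sum_congr rfl e]
    rw [← Finset.sum_image (s := Icc 1 (n - s)) (g := fun l => l + s)
      (f := fun L => cycleMean (n - L) fun m => h (L ::ₘ m))]
    · refine Finset.sum_le_sum_of_subset_of_nonneg (fun L hL => ?_)
        fun _ _ _ => cycleMean_nonneg fun m => h0 _
      obtain ⟨l, hl, rfl⟩ := Finset.mem_image.1 hL
      rw [Finset.mem_Icc] at hl ⊢
      omega
    · intro a _ b _ hab
      simpa using hab
  · rw [cycleMean_const, mul_zero]

/-- Where `Q` holds, pick one short `s`: the other cycles have total length at least `n - K ≥ n /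
2`, and each of them contributes its length to the merging sum. Compare with `cycleMean_merge_le`.
-/
theorem cycleProb_le_of_merge {n K : ℕ} (hK : 2 * K ≤ n) {Q R : Multiset ℕ → Prop}
    (hsmall : ∀ m, Q m → ∃ s ∈ m, s ≤ K)
    (hmerge : ∀ m, Q m → ∀ s ∈ m, s ≤ K → ∀ l ∈ m.erase s,
      R ((l + s) ::ₘ (m.erase s).erase l)) :
    cycleProb n Q ≤ 2 * invSum (· ≤ K) n * cycleProb n R := by
  classical
  rcases Nat.eq_zero_or_pos n with rfl | hn
  · have : cycleProb 0 Q = 0 := by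
      rw [cycleProb, cycleMean_zero, if_neg]
      intro h
      obtain ⟨s, hs, -⟩ := hsmall 0 h
      simp at hs
    rw [this]
    exact mul_nonneg (mul_nonneg zero_le_two (invSum_nonneg _ _)) (cycleProb_nonneg _ _)
  have hn' : (0 : ℝ) < n := by exact_mod_cast hn
  set h : Multiset ℕ → ℝ := fun m => if R m then 1 else 0 with hdef
  have hpos : ∀ m, 0 ≤ h m := fun m => by rw [hdef]; dsimp only; split_ifs <;> norm_num
  have key := cycleMean_merge_le n K hpos
  have hin : ∀ (m : Multiset ℕ) (s : ℕ), 0 ≤ if s ≤ K then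
      ((m.erase s).map fun l : ℕ => (l : ℝ) * h ((l + s) ::ₘ (m.erase s).erase l)).sum else 0 := by
    intro m s
    split_ifs
    · refine Multiset.sum_nonneg fun x hx => ?_
      obtain ⟨l, -, rfl⟩ := Multiset.mem_map.1 hx
      exact mul_nonneg (Nat.cast_nonneg _) (hpos _)
    · exact le_rfl
  have h1 : cycleMean n (fun m => (n / 2 : ℝ) * if Q m then 1 else 0)
      ≤ n * invSum (· ≤ K) n * cycleMean n h := by
    refine le_trans (cycleMean_mono fun m hm _ => ?_) key
    split_ifs with hQ
    · obtain ⟨s, hs, hsK⟩ := hsmall m hQ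
      refine le_trans ?_ (Multiset.single_le_sum (fun x hx => ?_) _
        (Multiset.mem_map_of_mem _ hs))
      · rw [if_pos hsK]
        have e : ((m.erase s).map fun l : ℕ => (l : ℝ) * h ((l + s) ::ₘ (m.erase s).erase l))
            = (m.erase s).map fun l : ℕ => (l : ℝ) := by
          refine Multiset.map_congr rfl fun l hl => ?_
          rw [hdef]; dsimp only
          rw [if_pos (hmerge m hQ s hs hsK l hl), mul_one]
        have e2 : ((m.erase s).map fun l : ℕ => (l : ℝ)).sum = ((m.erase s).sum : ℝ) :=
          (map_multiset_sum (Nat.castRingHom ℝ) _).symm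
        rw [e, e2]
        have e3 := Multiset.sum_erase hs
        have e4 : n ≤ 2 * (m.erase s).sum := by omega
        have e5 : (n : ℝ) ≤ 2 * ((m.erase s).sum : ℝ) := by exact_mod_cast e4
        linarith
      · obtain ⟨l, -, rfl⟩ := Multiset.mem_map.1 hx
        exact hin m l
    · rw [mul_zero]
      refine Multiset.sum_nonneg fun x hx => ?_
      obtain ⟨l, -, rfl⟩ := Multiset.mem_map.1 hx
      exact hin m l
  rw [cycleMean_const_mul] at h1
  unfold cycleProb
  have h2 : (n : ℝ) * cycleMean n (fun m => if Q m then (1 : ℝ) else 0)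
      ≤ n * (2 * invSum (· ≤ K) n * cycleMean n h) := by linarith
  exact le_of_mul_le_mul_left h2 hn'

/-! ### Subset sums of one random cycle type -/

/-- `HasSubsetSum m k` says that a permutation with cycle lengths `m` has an invariant set of
size `k`. -/
def HasSubsetSum (m : Multiset ℕ) (k : ℕ) : Prop := ∃ s ≤ m, s.sum = k

/-- The number of cycles of length at most `2 ^ j` exceeds `18 / 25 * j`. -/
def ManyShort (j : ℕ) (m : Multiset ℕ) : Prop := 18 * j < 25 * m.countP (· ≤ 2 ^ j)

/-- The geometric rate at which the probability of `ManyShort j` decays. -/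
noncomputable def shortRate : ℝ := Real.exp ((Real.log 2 - 18 * Real.log (26 / 25)) / 25)

theorem shortRate_lt_one : shortRate < 1 := by
  unfold shortRate
  rw [Real.exp_lt_one_iff]
  -- Numerically `(26 / 25) ^ 18` is just above `2`.
  have h : Real.log 2 < Real.log ((26 / 25 : ℝ) ^ 18) :=
    Real.log_lt_log (by norm_num) (by norm_num)
  rw [Real.log_pow] at h
  push_cast at h
  linarith

/-- A Chernoff bound with base `26 / 25`: the count has mean at most `1 + j * log 2`, and `log 2 <
18 / 25`. -/
theorem cycleProb_manyShort_le (n j : ℕ) : cycleProb n (ManyShort j) ≤ 3 * shortRate ^ j := by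
  set L := Real.log (26 / 25) with hL
  have hL0 : 0 < L := Real.log_pos (by norm_num)
  have h1 : cycleProb n (ManyShort j)
      ≤ cycleMean n fun m => Real.exp (-(18 / 25 * j * L)) *
          (1 + 1 / 25 : ℝ) ^ m.countP (· ≤ 2 ^ j) := by
    refine cycleProb_le_cycleMean (fun m => by positivity) fun m _ _ hQ => ?_
    have hQ' : (18 * j : ℝ) < 25 * (m.countP (· ≤ 2 ^ j) : ℝ) := by exact_mod_cast hQ
    have e : (1 + 1 / 25 : ℝ) = Real.exp L := by
      rw [hL, Real.exp_log (by norm_num)]; norm_num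
    rw [e, ← Real.exp_nat_mul, ← Real.exp_add, Real.one_le_exp_iff]
    nlinarith
  refine h1.trans ?_
  rw [cycleMean_const_mul]
  have h2 := cycleMean_pow_countP_le (· ≤ 2 ^ j) n (y := 1 / 25) (by norm_num)
  have h3 := invSum_le (2 ^ j) n
  push_cast at h3
  rw [Real.log_pow] at h3
  have h4 : Real.exp (1 / 25 * invSum (· ≤ 2 ^ j) n)
      ≤ Real.exp 1 * Real.exp (j * Real.log 2 / 25) := by
    rw [← Real.exp_add]
    apply Real.exp_le_exp.2
    linarith
  have h5 : Real.exp (-(18 / 25 * j * L)) * Real.exp (j * Real.log 2 / 25) = shortRate ^ j := by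
    rw [shortRate, ← Real.exp_nat_mul, ← Real.exp_add]
    congr 1; ring
  calc _ ≤ Real.exp (-(18 / 25 * j * L)) * (Real.exp 1 * Real.exp (j * Real.log 2 / 25)) :=
        mul_le_mul_of_nonneg_left (h2.trans h4) (Real.exp_nonneg _)
    _ = Real.exp 1 * shortRate ^ j := by rw [← h5]; ring
    _ ≤ 3 * shortRate ^ j := by
        refine mul_le_mul_of_nonneg_right ?_ (pow_nonneg (Real.exp_nonneg _) _)
        have := Real.exp_one_lt_d9
        linarith

theorem two_pow_clog_le {k : ℕ} (hk : 0 < k) : 2 ^ Nat.clog 2 k ≤ 2 * k := by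
  rcases Nat.lt_or_ge 1 k with h | h
  · have h1 := Nat.pow_pred_clog_lt_self (b := 2) (by norm_num) h
    have h2 : 0 < Nat.clog 2 k := Nat.clog_pos (by norm_num) h
    obtain ⟨c, hc⟩ := Nat.exists_eq_add_of_lt h2
    rw [hc] at h1 ⊢
    simp only [zero_add, Nat.pred_eq_sub_one, Nat.add_sub_cancel] at h1 ⊢
    rw [pow_succ]
    omega
  · have : k = 1 := by omega
    subst this; simp

/-- With `N` cycles of length at most `k`, the event bounds `2 ^ N` by `2 * k ^ (18 / 25)`. Its
indicator is therefore at most that bound times the number of subset sums equal to `k`, weighted by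
`2 ^ (-N)`; this weighted count has mean `halfMean k k * halfMean k (n - k) ≤ 4 / k`. -/
theorem cycleProb_hasSubsetSum_le {n k : ℕ} (hk : 0 < k) (hn : 2 * k ≤ n) :
    cycleProb n (fun m => HasSubsetSum m k ∧ ¬ ManyShort (Nat.clog 2 k) m)
      ≤ 8 * (k : ℝ) ^ (-(7 / 25) : ℝ) := by
  have hk' : (0 : ℝ) < k := by exact_mod_cast hk
  have h1 : cycleProb n (fun m => HasSubsetSum m k ∧ ¬ ManyShort (Nat.clog 2 k) m)
      ≤ cycleMean n fun m => 2 * (k : ℝ) ^ (18 / 25 : ℝ) *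
        (subsetSumCount k m * (m.map fun l => if l ≤ k then (1 / 2 : ℝ) else 1).prod) := by
    refine cycleProb_le_cycleMean (fun m => ?_) fun m _ _ hQ => ?_
    · rw [prod_map_ite_half]; positivity
    · obtain ⟨hs, hshort⟩ := hQ
      have hc : (1 : ℝ) ≤ subsetSumCount k m := by
        exact_mod_cast subsetSumCount_pos_iff.2 hs
      rw [prod_map_ite_half]
      set N := m.countP (· ≤ k) with hN
      set j := Nat.clog 2 k with hj
      have hkj : k ≤ 2 ^ j := Nat.le_pow_clog (by norm_num) k
      have hNj : N ≤ m.countP (· ≤ 2 ^ j) := by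
        rw [hN, Multiset.countP_eq_card_filter, Multiset.countP_eq_card_filter]
        exact Multiset.card_le_card
          (Multiset.monotone_filter_right m fun l hl => le_trans hl hkj)
      have hNle : 25 * N ≤ 18 * j := by
        unfold ManyShort at hshort
        omega
      have hNle' : (N : ℝ) ≤ 18 / 25 * j := by
        have : (25 * N : ℝ) ≤ 18 * j := by exact_mod_cast hNle
        linarith
      have h2N : (2 : ℝ) ^ N ≤ 2 * (k : ℝ) ^ (18 / 25 : ℝ) := by
        calc (2 : ℝ) ^ N = (2 : ℝ) ^ (N : ℝ) := (Real.rpow_natCast _ _).symm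
          _ ≤ (2 : ℝ) ^ ((j : ℝ) * (18 / 25)) :=
            Real.rpow_le_rpow_of_exponent_le (by norm_num) (by linarith)
          _ = ((2 : ℝ) ^ j) ^ (18 / 25 : ℝ) := by
            rw [Real.rpow_mul (by norm_num), Real.rpow_natCast]
          _ ≤ (2 * k : ℝ) ^ (18 / 25 : ℝ) := by
            refine Real.rpow_le_rpow (by positivity) ?_ (by norm_num)
            exact_mod_cast two_pow_clog_le hk
          _ = (2 : ℝ) ^ (18 / 25 : ℝ) * (k : ℝ) ^ (18 / 25 : ℝ) :=
            Real.mul_rpow (by norm_num) hk'.le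
          _ ≤ 2 * (k : ℝ) ^ (18 / 25 : ℝ) := by
            refine mul_le_mul_of_nonneg_right ?_ (by positivity)
            calc (2 : ℝ) ^ (18 / 25 : ℝ) ≤ (2 : ℝ) ^ (1 : ℝ) :=
                  Real.rpow_le_rpow_of_exponent_le (by norm_num) (by norm_num)
              _ = 2 := Real.rpow_one _
      calc (1 : ℝ) = 2 ^ N * (1 * (1 / 2) ^ N) := by
            rw [one_mul, ← mul_pow]; norm_num
        _ ≤ _ := by
            refine mul_le_mul h2N ?_ (by positivity) (by positivity)
            exact mul_le_mul_of_nonneg_right hc (by positivity)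
  refine h1.trans ?_
  rw [cycleMean_const_mul, cycleMean_subsetSumCount_mul_prod, if_pos (by omega)]
  have h2 := halfMean_le_of_le (le_refl k)
  have h3 := halfMean_le (n := n - k) hk (by omega)
  rw [if_neg hk.ne'] at h2
  have h4 : halfMean k k * halfMean k (n - k) ≤ 1 / √k * (4 / √k) :=
    mul_le_mul h2 h3 (halfMean_nonneg _ _) (by positivity)
  have h5 : 1 / √(k : ℝ) * (4 / √k) = 4 * (k : ℝ)⁻¹ := by
    rw [div_mul_div_comm, Real.mul_self_sqrt hk'.le]; ring
  have h6 : (k : ℝ) ^ (-(7 / 25) : ℝ) = (k : ℝ) ^ (18 / 25 : ℝ) * (k : ℝ)⁻¹ := by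
    rw [← Real.rpow_neg_one, ← Real.rpow_add hk']
    norm_num
  rw [h5] at h4
  calc _ ≤ 2 * (k : ℝ) ^ (18 / 25 : ℝ) * (4 * (k : ℝ)⁻¹) :=
        mul_le_mul_of_nonneg_left h4 (by positivity)
    _ = _ := by rw [h6]; ring

/-! ### Four independent permutations -/

/-- The probability that the cycle lengths of four independent uniform permutations of `n` points
satisfy `Q`. -/
noncomputable def cycleProb₄ (n : ℕ)
    (Q : Multiset ℕ → Multiset ℕ → Multiset ℕ → Multiset ℕ → Prop) : ℝ :=
  cycleMean n fun a => cycleMean n fun b => cycleMean n fun c => cycleProb n (Q a b c)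

section
variable {n : ℕ} {Q R : Multiset ℕ → Multiset ℕ → Multiset ℕ → Multiset ℕ → Prop}

theorem cycleProb₄_le_mul {C : ℝ} (H : ∀ a b c, cycleProb n (Q a b c) ≤ C * cycleProb n (R a b c)) :
    cycleProb₄ n Q ≤ C * cycleProb₄ n R := by
  unfold cycleProb₄
  simp_rw [← cycleMean_const_mul]
  exact cycleMean_mono fun a _ _ => cycleMean_mono fun b _ _ => cycleMean_mono fun c _ _ => H a b c

theorem cycleProb₄_mono
    (H : ∀ a b c d, a.sum = n → b.sum = n → c.sum = n → d.sum = n → Q a b c d → R a b c d) :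
    cycleProb₄ n Q ≤ cycleProb₄ n R :=
  cycleMean_mono fun a ha _ => cycleMean_mono fun b hb _ => cycleMean_mono fun c hc _ =>
    cycleProb_mono fun d hd _ => H a b c d ha hb hc hd

theorem cycleProb₄_or_le :
    cycleProb₄ n (fun a b c d => Q a b c d ∨ R a b c d) ≤ cycleProb₄ n Q + cycleProb₄ n R := by
  unfold cycleProb₄
  simp_rw [← cycleMean_add]
  exact cycleMean_mono fun a _ _ => cycleMean_mono fun b _ _ => cycleMean_mono fun c _ _ =>
    cycleProb_or_le n _ _

theorem cycleProb₄_not :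
    cycleProb₄ n (fun a b c d => ¬ Q a b c d) = 1 - cycleProb₄ n Q := by
  unfold cycleProb₄
  simp_rw [cycleProb_not, sub_eq_add_neg, cycleMean_add, cycleMean_const]
  simp_rw [← neg_one_mul (cycleProb _ _), cycleMean_const_mul]
  ring

/-- `cycleProb₄_le_mul` compares events in the last coordinate only; this brings the third one
there. -/
theorem cycleProb₄_swap : cycleProb₄ n Q = cycleProb₄ n fun a b c d => Q a b d c := by
  classical
  simp only [cycleProb₄, cycleProb]
  exact cycleMean_congr fun a _ _ => cycleMean_congr fun b _ _ =>
    cycleMean_comm n n fun c d => if Q a b c d then 1 else 0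

theorem cycleProb₄_coords (P : Multiset ℕ → Prop) :
    cycleProb₄ n (fun a b c d => P a ∨ P b ∨ P c ∨ P d) ≤ 4 * cycleProb n P := by
  have h1 : cycleProb₄ n (fun a _ _ _ => P a) = cycleProb n P := by
    simp [cycleProb₄, cycleProb, cycleMean_const]
  have h2 : cycleProb₄ n (fun _ b _ _ => P b) = cycleProb n P := by
    simp [cycleProb₄, cycleProb, cycleMean_const]
  have h3 : cycleProb₄ n (fun _ _ c _ => P c) = cycleProb n P := by
    simp [cycleProb₄, cycleProb, cycleMean_const]
  have h4 : cycleProb₄ n (fun _ _ _ d => P d) = cycleProb n P := by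
    simp [cycleProb₄, cycleProb, cycleMean_const]
  refine cycleProb₄_or_le.trans ?_
  refine (add_le_add_right (cycleProb₄_or_le.trans (add_le_add_right cycleProb₄_or_le _)) _).trans ?_
  linarith

theorem cycleProb_exists_le {ι : Type*} (n : ℕ) (s : Finset ι) (A : ι → Multiset ℕ → Prop) :
    cycleProb n (fun m => ∃ k ∈ s, A k m) ≤ ∑ k ∈ s, cycleProb n (A k) := by
  classical
  unfold cycleProb
  rw [← cycleMean_sum]
  refine cycleMean_mono fun m _ _ => ?_
  have h0 : ∀ k ∈ s, (0 : ℝ) ≤ if A k m then 1 else 0 := fun k _ => by split_ifs <;> norm_num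
  split_ifs with h
  · obtain ⟨k, hk, hA⟩ := h
    refine le_trans ?_ (Finset.single_le_sum h0 hk)
    rw [if_pos hA]
  · exact Finset.sum_nonneg h0

theorem cycleProb₄_exists_le {ι : Type*} (s : Finset ι) (A : ι → Multiset ℕ → Prop) :
    cycleProb₄ n (fun a b c d => ∃ k ∈ s, A k a ∧ A k b ∧ A k c ∧ A k d)
      ≤ ∑ k ∈ s, cycleProb n (A k) ^ 4 := by
  classical
  have h1 : ∀ k, cycleProb n (A k) ^ 4
      = cycleProb₄ n (fun a b c d => A k a ∧ A k b ∧ A k c ∧ A k d) := by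
    intro k
    have e : ∀ a b c d [Decidable (A k a ∧ A k b ∧ A k c ∧ A k d)], (if A k a ∧ A k b ∧ A k c ∧ A k d then (1 : ℝ) else 0)
        = (if A k a then 1 else 0) * ((if A k b then 1 else 0) * ((if A k c then 1 else 0) *
          (if A k d then 1 else 0))) := by
      intro a b c d _
      by_cases ha : A k a <;> by_cases hb : A k b <;> by_cases hc : A k c <;>
        by_cases hd : A k d <;> simp [ha, hb, hc, hd]
    unfold cycleProb₄ cycleProb
    simp_rw [e, cycleMean_const_mul, cycleMean_mul_const]
    ring
  rw [Finset.sum_congr rfl fun k _ => h1 k]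
  refine le_trans (b := cycleMean n fun a => cycleMean n fun b => cycleMean n fun c =>
    ∑ k ∈ s, cycleProb n fun d => A k a ∧ A k b ∧ A k c ∧ A k d) ?_ (le_of_eq ?_)
  · exact cycleMean_mono fun a _ _ => cycleMean_mono fun b _ _ => cycleMean_mono fun c _ _ =>
      cycleProb_exists_le n s fun k d => A k a ∧ A k b ∧ A k c ∧ A k d
  · simp only [cycleProb₄, cycleMean_sum]
end

/-! ### Common subset sums of four cycle types -/

/-- No number in `(K, n / 2]` is a subset sum of all four multisets. -/
def NoCommonSum (n K : ℕ) (a b c d : Multiset ℕ) : Prop :=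
  ∀ k, K < k → 2 * k ≤ n →
    ¬ (HasSubsetSum a k ∧ HasSubsetSum b k ∧ HasSubsetSum c k ∧ HasSubsetSum d k)

theorem exists_forall_sum_lt_of_summable {f : ℕ → ℝ} (hf : Summable f) {ε : ℝ} (hε : 0 < ε) :
    ∃ N : ℕ, ∀ t : Finset ℕ, (∀ x ∈ t, N ≤ x) → ∑ x ∈ t, f x < ε := by
  obtain ⟨s, hs⟩ := summable_iff_vanishing_norm.1 hf ε hε
  refine ⟨s.sup id + 1, fun t ht => ?_⟩
  refine (le_abs_self _).trans_lt (hs t ?_)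
  rw [Finset.disjoint_left]
  intro x hxt hxs
  have h1 := ht x hxt
  have h2 : x ≤ s.sup id := Finset.le_sup (f := id) hxs
  omega

/-- A union bound: `ManyShort j` for some `j ≥ J` in one of the four permutations, or a common sum
`k > 2 ^ J` without it. Both bounds are tails of convergent series. -/
theorem exists_noCommonSum {ε : ℝ} (hε : 0 < ε) :
    ∃ J₀ : ℕ, ∀ J ≥ J₀, ∀ n : ℕ,
      cycleProb₄ n (fun a b c d => ¬ NoCommonSum n (2 ^ J) a b c d) < ε := by
  have hs1 : Summable fun j : ℕ => 3 * shortRate ^ j :=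
    (summable_geometric_of_lt_one (Real.exp_nonneg _) shortRate_lt_one).mul_left _
  have hs2 : Summable fun k : ℕ => 4096 * (k : ℝ) ^ (-(28 / 25) : ℝ) :=
    (Real.summable_nat_rpow.2 (by norm_num)).mul_left _
  obtain ⟨N₁, hN₁⟩ := exists_forall_sum_lt_of_summable hs1 (show 0 < ε / 8 by positivity)
  obtain ⟨N₂, hN₂⟩ := exists_forall_sum_lt_of_summable hs2 (show 0 < ε / 2 by positivity)
  refine ⟨max N₁ N₂, fun J hJ n => ?_⟩
  have hJ1 : N₁ ≤ J := (le_max_left _ _).trans hJ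
  have hJ2 : N₂ ≤ 2 ^ J := ((le_max_right _ _).trans hJ).trans Nat.lt_two_pow_self.le
  set B : Multiset ℕ → Prop := fun m => ∃ j ∈ Icc J n, ManyShort j m with hB
  set S : Finset ℕ := (Ioc (2 ^ J) n).filter (2 * · ≤ n) with hS
  set A : ℕ → Multiset ℕ → Prop := fun k m => HasSubsetSum m k ∧ ¬ ManyShort (Nat.clog 2 k) m
    with hA
  have h1 : cycleProb₄ n (fun a b c d => ¬ NoCommonSum n (2 ^ J) a b c d)
      ≤ cycleProb₄ n (fun a b c d => (B a ∨ B b ∨ B c ∨ B d) ∨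
          ∃ k ∈ S, A k a ∧ A k b ∧ A k c ∧ A k d) := by
    refine cycleProb₄_mono fun a b c d _ _ _ _ h => ?_
    unfold NoCommonSum at h
    push Not at h
    obtain ⟨k, hk, hkn, ha, hb, hc, hd⟩ := h
    have hj : Nat.clog 2 k ∈ Icc J n := by
      rw [Finset.mem_Icc]
      constructor
      · exact ((Nat.lt_clog_iff_pow_lt (by norm_num)).2 hk).le
      · exact (Nat.clog_le_of_le_pow Nat.lt_two_pow_self.le).trans (by omega)
    by_cases hbad : B a ∨ B b ∨ B c ∨ B d
    · exact Or.inl hbad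
    · right
      push Not at hbad
      obtain ⟨na, nb, nc, nd⟩ := hbad
      have good : ∀ m, ¬ B m → ¬ ManyShort (Nat.clog 2 k) m := fun m hm h => hm ⟨_, hj, h⟩
      refine ⟨k, ?_, ⟨ha, good a na⟩, ⟨hb, good b nb⟩, ⟨hc, good c nc⟩, ⟨hd, good d nd⟩⟩
      rw [hS, Finset.mem_filter, Finset.mem_Ioc]
      omega
  have h2 : cycleProb n B < ε / 8 := by
    refine ((cycleProb_exists_le n _ _).trans
      (Finset.sum_le_sum fun j _ => cycleProb_manyShort_le n j)).trans_lt (hN₁ _ fun j hj => ?_)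
    exact hJ1.trans (Finset.mem_Icc.1 hj).1
  have h3 : ∑ k ∈ S, cycleProb n (A k) ^ 4 < ε / 2 := by
    refine lt_of_le_of_lt (Finset.sum_le_sum fun k hk => ?_) (hN₂ S fun k hk => ?_)
    · rw [hS, Finset.mem_filter, Finset.mem_Ioc] at hk
      have hk0 : 0 < k := by omega
      have := cycleProb_hasSubsetSum_le hk0 hk.2
      -- Here `8 ^ 4 = 4096`, and `4 * (7 / 25) = 28 / 25` exceeds `1`.
      refine (pow_le_pow_left₀ (cycleProb_nonneg _ _) this 4).trans (le_of_eq ?_)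
      rw [mul_pow, ← Real.rpow_mul_natCast (Nat.cast_nonneg k)]
      norm_num
    · rw [hS, Finset.mem_filter, Finset.mem_Ioc] at hk
      omega
  have h4 := h1.trans (cycleProb₄_or_le.trans
    (add_le_add (cycleProb₄_coords B) (cycleProb₄_exists_le S A)))
  linarith

/-! ### Removing short cycles and adjusting the parity -/

/-- A sum using the merged part uses both original parts, so merging can only lose subset sums.
Absence of common sums thus survives it. -/
theorem HasSubsetSum.of_merge {m : Multiset ℕ} {s l k : ℕ} (hs : s ∈ m) (hl : l ∈ m.erase s)
    (h : HasSubsetSum ((l + s) ::ₘ (m.erase s).erase l) k) : HasSubsetSum m k := by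
  obtain ⟨t, ht, rfl⟩ := h
  have hm : m = s ::ₘ l ::ₘ (m.erase s).erase l := by
    rw [Multiset.cons_erase hl, Multiset.cons_erase hs]
  by_cases hmem : l + s ∈ t
  · refine ⟨s ::ₘ l ::ₘ t.erase (l + s), ?_, ?_⟩
    · rw [hm]
      refine Multiset.cons_le_cons _ (Multiset.cons_le_cons _ ?_)
      have := Multiset.erase_le_erase (l + s) ht
      rwa [Multiset.erase_cons_head] at this
    · have := Multiset.sum_erase hmem
      simp only [Multiset.sum_cons]
      omega
  · refine ⟨t, ((Multiset.le_cons_of_notMem hmem).1 ht).trans ?_, rfl⟩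
    exact (Multiset.erase_le _ _).trans (Multiset.erase_le _ _)

theorem NoCommonSum.merge {n K : ℕ} {a b c d : Multiset ℕ} {s l : ℕ} (hs : s ∈ d)
    (hl : l ∈ d.erase s) (h : NoCommonSum n K a b c d) :
    NoCommonSum n K a b c ((l + s) ::ₘ (d.erase s).erase l) :=
  fun k hk hkn ⟨ha, hb, hc, hd⟩ => h k hk hkn ⟨ha, hb, hc, hd.of_merge hs hl⟩

/-- Merging a short cycle into any other lowers the number of short cycles by at least one, since `l
+ s ≤ K` forces `l ≤ K`. Each of `r` rounds costs one constant factor. -/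
theorem cycleProb_shortCycles_le {n K : ℕ} (hK : 2 * K ≤ n) {Q : Multiset ℕ → Prop}
    (hQ : ∀ m, Q m → ∀ s ∈ m, ∀ l ∈ m.erase s, Q ((l + s) ::ₘ (m.erase s).erase l)) (r : ℕ) :
    cycleProb n (fun m => Q m ∧ m.countP (· ≤ K) ≤ r)
      ≤ (1 + 2 * invSum (· ≤ K) n) ^ r * cycleProb n fun m => Q m ∧ ∀ l ∈ m, K < l := by
  induction r with
  | zero =>
    rw [pow_zero, one_mul]
    refine cycleProb_mono fun m _ _ h => ⟨h.1, fun l hl => ?_⟩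
    have := Multiset.countP_eq_zero.1 (Nat.le_zero.1 h.2) l hl
    omega
  | succ r ih =>
    have h1 : cycleProb n (fun m => Q m ∧ m.countP (· ≤ K) ≤ r + 1)
        ≤ cycleProb n (fun m => Q m ∧ m.countP (· ≤ K) ≤ r)
          + cycleProb n fun m => Q m ∧ m.countP (· ≤ K) = r + 1 := by
      refine le_trans (cycleProb_mono fun m _ _ h => ?_) (cycleProb_or_le n _ _)
      rcases Nat.lt_or_ge (m.countP (· ≤ K)) (r + 1) with h2 | h2
      · exact Or.inl ⟨h.1, by omega⟩
      · exact Or.inr ⟨h.1, by omega⟩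
    have h2 : cycleProb n (fun m => Q m ∧ m.countP (· ≤ K) = r + 1)
        ≤ 2 * invSum (· ≤ K) n * cycleProb n fun m => Q m ∧ m.countP (· ≤ K) ≤ r := by
      refine cycleProb_le_of_merge hK (fun m h => ?_) fun m h s hs hsK l hl =>
        ⟨hQ m h.1 s hs l hl, ?_⟩
      · have : 0 < m.countP (· ≤ K) := by omega
        exact Multiset.countP_pos.1 this
      · have hm : m = s ::ₘ l ::ₘ (m.erase s).erase l := by
          rw [Multiset.cons_erase hl, Multiset.cons_erase hs]
        have h3 := h.2
        rw [hm, Multiset.countP_cons, Multiset.countP_cons, if_pos hsK] at h3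
        rw [Multiset.countP_cons]
        split_ifs at h3 ⊢ <;> omega
    have h0 := invSum_nonneg (· ≤ K) n
    calc _ ≤ (1 + 2 * invSum (· ≤ K) n) * cycleProb n
          (fun m => Q m ∧ m.countP (· ≤ K) ≤ r) := by linarith
      _ ≤ _ := by
        rw [pow_succ', mul_assoc]
        exact mul_le_mul_of_nonneg_left ih (by positivity)

/-- A merge preserves the sum and changes the number of cycles by one, so it reverses the sign of
the permutation. -/
theorem cycleProb_le_odd {n K : ℕ} (hK : 2 * K ≤ n) {Q : Multiset ℕ → Prop}
    (hQ : ∀ m, Q m → ∀ s ∈ m, ∀ l ∈ m.erase s, Q ((l + s) ::ₘ (m.erase s).erase l)) :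
    cycleProb n (fun m => Q m ∧ ∃ s ∈ m, s ≤ K)
      ≤ (1 + 2 * invSum (· ≤ K) n) *
        cycleProb n fun m => Q m ∧ Odd (m.sum + Multiset.card m) := by
  have h1 : cycleProb n (fun m => Q m ∧ ∃ s ∈ m, s ≤ K)
      ≤ cycleProb n (fun m => Q m ∧ Odd (m.sum + Multiset.card m))
        + cycleProb n fun m => (Q m ∧ ∃ s ∈ m, s ≤ K) ∧ Even (m.sum + Multiset.card m) := by
    refine le_trans (cycleProb_mono fun m _ _ h => ?_) (cycleProb_or_le n _ _)
    rcases Nat.even_or_odd (m.sum + Multiset.card m) with h2 | h2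
    · exact Or.inr ⟨h, h2⟩
    · exact Or.inl ⟨h.1, h2⟩
  have h2 : cycleProb n (fun m => (Q m ∧ ∃ s ∈ m, s ≤ K) ∧ Even (m.sum + Multiset.card m))
      ≤ 2 * invSum (· ≤ K) n * cycleProb n fun m => Q m ∧ Odd (m.sum + Multiset.card m) := by
    refine cycleProb_le_of_merge hK (fun m h => h.1.2) fun m h s hs _ l hl =>
      ⟨hQ m h.1.1 s hs l hl, ?_⟩
    have hm : m = s ::ₘ l ::ₘ (m.erase s).erase l := by
      rw [Multiset.cons_erase hl, Multiset.cons_erase hs]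
    have h3 := h.2
    rw [hm] at h3
    simp only [Multiset.sum_cons, Multiset.card_cons] at h3 ⊢
    rw [Nat.odd_iff]; rw [Nat.even_iff] at h3
    omega
  linarith

theorem exists_le_cycleProb₄ : ∃ (K : ℕ) (c : ℝ), 0 < c ∧ ∀ n, 2 * K ≤ n →
    c ≤ cycleProb₄ n fun a b c d => NoCommonSum n K a b c d ∧ (∀ l ∈ d, K < l) ∧
      Odd (c.sum + Multiset.card c) := by
  obtain ⟨J₀, hJ₀⟩ := exists_noCommonSum (show (0 : ℝ) < 1 / 8 by norm_num)
  -- `J ≥ 10` gives `√K ≥ 32`, hence `4 / √K ≤ 1 / 8` in `e3`.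
  set J := max J₀ 10 with hJ
  set K := 2 ^ J with hK
  have hKpos : 0 < K := by positivity
  set H : ℝ := 1 + Real.log K with hH
  have hlog : 0 ≤ Real.log K := Real.log_nonneg (by exact_mod_cast hKpos)
  have hHpos : 0 < H := by linarith
  -- By Markov's inequality, more than `R` short cycles then have probability at most `1 / 8`.
  obtain ⟨R, hR⟩ := exists_nat_ge (8 * H)
  have hB : 0 < 1 + 2 * H := by linarith
  refine ⟨K, (2 * (1 + 2 * H) ^ (R + 1))⁻¹, by positivity, fun n hn => ?_⟩
  have hinv : invSum (· ≤ K) n ≤ H := invSum_le K n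
  have hinv0 := invSum_nonneg (· ≤ K) n
  have e1 : cycleProb₄ n (fun a b c d => ¬ NoCommonSum n K a b c d) ≤ 1 / 8 :=
    (hJ₀ J (le_max_left _ _) n).le
  have e2 : cycleProb₄ n (fun _ _ _ d => R < d.countP (· ≤ K)) ≤ 1 / 8 := by
    have : cycleProb₄ n (fun _ _ _ d => R < d.countP (· ≤ K))
        = cycleProb n fun d => R < d.countP (· ≤ K) := by
      simp [cycleProb₄, cycleProb, cycleMean_const]
    rw [this]
    refine (cycleProb_lt_countP_le _ n R).trans ?_
    rw [div_le_iff₀ (by positivity)]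
    linarith
  have e3 : cycleProb₄ n (fun _ _ c _ => ∀ l ∈ c, K < l) ≤ 1 / 8 := by
    have : cycleProb₄ n (fun _ _ c _ => ∀ l ∈ c, K < l)
        = cycleProb n fun c => ∀ l ∈ c, K < l := by
      simp [cycleProb₄, cycleProb, cycleMean_const]
    rw [this]
    refine (cycleProb_forall_lt_le hKpos (by omega)).trans ?_
    have h32 : (32 : ℝ) ≤ √K := by
      apply Real.le_sqrt_of_sq_le
      have : 2 ^ 10 ≤ K := Nat.pow_le_pow_right (by norm_num) (le_max_right _ _)
      have : ((2 ^ 10 : ℕ) : ℝ) ≤ K := by exact_mod_cast this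
      norm_num at this ⊢
      linarith
    rw [div_le_iff₀ (by linarith)]
    linarith
  -- Three bad events of probability at most `1 / 8` leave `5 / 8`.
  have e4 : (1 : ℝ) / 2 ≤ cycleProb₄ n fun a b c d =>
      (NoCommonSum n K a b c d ∧ ∃ s ∈ c, s ≤ K) ∧ d.countP (· ≤ K) ≤ R := by
    have h1 : 1 - cycleProb₄ n (fun a b c d =>
          (NoCommonSum n K a b c d ∧ ∃ s ∈ c, s ≤ K) ∧ d.countP (· ≤ K) ≤ R)
        ≤ cycleProb₄ n (fun a b c d => ¬ NoCommonSum n K a b c d ∨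
          (R < d.countP (· ≤ K) ∨ ∀ l ∈ c, K < l)) := by
      rw [← cycleProb₄_not]
      refine cycleProb₄_mono fun a b c d _ _ _ _ h => ?_
      by_contra hcon
      push Not at hcon
      exact h ⟨⟨hcon.1, hcon.2.2⟩, hcon.2.1⟩
    have h2 := h1.trans (cycleProb₄_or_le.trans
      (add_le_add e1 (cycleProb₄_or_le.trans (add_le_add e2 e3))))
    linarith
  have e5 := e4.trans (cycleProb₄_le_mul (C := (1 + 2 * H) ^ R)
    (R := fun a b c d => (NoCommonSum n K a b c d ∧ ∃ s ∈ c, s ≤ K) ∧ ∀ l ∈ d, K < l)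
    fun a b c => (cycleProb_shortCycles_le hn
      (fun m hm s hs l hl => ⟨hm.1.merge hs hl, hm.2⟩) R).trans
      (mul_le_mul_of_nonneg_right (pow_le_pow_left₀ (by positivity) (by linarith) R)
        (cycleProb_nonneg _ _)))
  -- The parity merge acts on the third permutation, so that the fourth stays free of short cycles;
  -- the two are exchanged here and exchanged back afterwards.
  rw [cycleProb₄_swap] at e5
  have e6 : cycleProb₄ n (fun a b c d => (NoCommonSum n K a b d c ∧ ∃ s ∈ d, s ≤ K) ∧
        ∀ l ∈ c, K < l)
      ≤ (1 + 2 * H) * cycleProb₄ n fun a b c d =>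
        (NoCommonSum n K a b d c ∧ ∀ l ∈ c, K < l) ∧ Odd (d.sum + Multiset.card d) := by
    refine cycleProb₄_le_mul fun a b c => ?_
    refine le_trans (cycleProb_mono fun d _ _ h => ?_) ((cycleProb_le_odd hn
      (Q := fun d => NoCommonSum n K a b d c ∧ ∀ l ∈ c, K < l) fun m hm s hs l hl =>
        ⟨fun k hk hkn ⟨ha, hb, hc, hd⟩ => hm.1 k hk hkn ⟨ha, hb, hc.of_merge hs hl, hd⟩,
          hm.2⟩).trans (mul_le_mul_of_nonneg_right (by linarith) (cycleProb_nonneg _ _)))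
    exact ⟨⟨h.1.1, h.2⟩, h.1.2⟩
  rw [cycleProb₄_swap (Q := fun a b c d =>
    (NoCommonSum n K a b d c ∧ ∀ l ∈ c, K < l) ∧ Odd (d.sum + Multiset.card d))] at e6
  simp only [and_assoc] at e6 e5 ⊢
  rw [inv_le_iff_one_le_mul₀ (by positivity)]
  have e7 := mul_le_mul_of_nonneg_left e6 (show 0 ≤ (1 + 2 * H) ^ R by positivity)
  rw [pow_succ]
  nlinarith

/-! ### A prime cycle length dividing no other cycle length -/

/-- Some part of `m` is a prime at most `n / 2` which divides no other part. -/
def HasIsolatedPrime (n : ℕ) (m : Multiset ℕ) : Prop :=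
  ∃ p ∈ m, p.Prime ∧ 2 * p ≤ n ∧ ∀ l ∈ m.erase p, ¬ p ∣ l

/-- Chebyshev's inequality: by the bound on the second factorial moment, `1 - N / s` has mean square
at most `1 / s`, and it equals `1` when the count `N` vanishes. -/
theorem cycleProb_countP_eq_zero_le (q : ℕ → Prop) [DecidablePred q] (n : ℕ)
    (hs : 0 < invSum q n) : cycleProb n (fun m => m.countP q = 0) ≤ 1 / invSum q n := by
  set s := invSum q n with hsdef
  have h1 : cycleProb n (fun m => m.countP q = 0)
      ≤ cycleMean n fun m => (1 - m.countP q / s) ^ 2 := by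
    refine cycleProb_le_cycleMean (fun m => sq_nonneg _) fun m _ _ hQ => ?_
    rw [hQ]; simp
  have e : ∀ m : Multiset ℕ, (1 - (m.countP q : ℝ) / s) ^ 2
      = 1 + ((s⁻¹ ^ 2 - 2 * s⁻¹) * (m.countP q : ℝ)
        + (2 * s⁻¹ ^ 2) * ((m.countP q).choose 2 : ℝ)) := by
    intro m
    rw [Nat.cast_choose_two]; ring
  simp_rw [e] at h1
  rw [cycleMean_add, cycleMean_add, cycleMean_const_mul, cycleMean_const_mul, cycleMean_one,
    cycleMean_countP, ← hsdef] at h1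
  have h2 := cycleMean_choose_countP_le q (le_refl n) 2
  rw [← hsdef] at h2
  have h3 := mul_le_mul_of_nonneg_left h2 (show 0 ≤ 2 * s⁻¹ ^ 2 by positivity)
  have h4 : 2 * s⁻¹ ^ 2 * (s ^ 2 / (Nat.factorial 2 : ℝ)) = 1 := by
    simp [Nat.factorial]
    field_simp
  have h5 : (s⁻¹ ^ 2 - 2 * s⁻¹) * s = 1 / s - 2 := by field_simp
  linarith

theorem invSum_dvd_le {p : ℕ} (hp : 0 < p) (n : ℕ) :
    invSum (p ∣ ·) n ≤ (p : ℝ)⁻¹ * (1 + Real.log n) := by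
  have h := harmonic_le_one_add_log n
  rw [harmonic_eq_sum_Icc] at h
  push_cast at h
  refine le_trans ?_ (mul_le_mul_of_nonneg_left h (by positivity))
  rw [Finset.mul_sum]
  have e : ∑ i ∈ Icc 1 n, (p : ℝ)⁻¹ * (i : ℝ)⁻¹
      = ∑ j ∈ (Icc 1 n).image (p * ·), (j : ℝ)⁻¹ := by
    rw [Finset.sum_image fun a _ b _ hab => Nat.eq_of_mul_eq_mul_left hp hab]
    refine Finset.sum_congr rfl fun i _ => ?_
    push_cast; rw [mul_inv]
  rw [e]
  refine Finset.sum_le_sum_of_subset_of_nonneg (fun j hj => ?_) fun _ _ _ => by positivity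
  simp only [Finset.mem_filter, Finset.mem_Icc] at hj
  obtain ⟨⟨h1, h2⟩, i, rfl⟩ := hj
  refine Finset.mem_image.2 ⟨i, Finset.mem_Icc.2 ⟨?_, ?_⟩, rfl⟩
  · exact Nat.pos_of_mul_pos_left h1
  · exact (Nat.le_mul_of_pos_left i hp).trans h2

/-- Failure means that no cycle length satisfies `q`, or that such a length `p` divides another one.
`D` counts these divisible pairs; a fixed `p` contributes at most `(1 + log n) / p ^ 2`, and `p > y`
makes the total at most `(1 + log n) / y`. -/
theorem cycleProb_not_hasIsolatedPrime_le {n y : ℕ} (hy : 0 < y) (hyn : y ≤ n)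
    (q : ℕ → Prop) [DecidablePred q] (hq : ∀ j, q j → j.Prime ∧ y < j ∧ 2 * j ≤ n)
    (hs : 0 < invSum q n) :
    cycleProb n (fun m => ¬ HasIsolatedPrime n m)
      ≤ 1 / invSum q n + (1 + Real.log n) / y := by
  set D : Multiset ℕ → ℝ := fun m =>
    (m.map fun p => if q p then (((m.erase p).countP (p ∣ ·) : ℕ) : ℝ) else 0).sum with hD
  have hn : 0 < n := hy.trans_le hyn
  have hlog : 0 ≤ Real.log n := Real.log_nonneg (by exact_mod_cast hn)
  have h1 : cycleProb n (fun m => ¬ HasIsolatedPrime n m)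
      ≤ cycleProb n (fun m => m.countP q = 0) + cycleProb n fun m => 1 ≤ D m := by
    refine le_trans (cycleProb_mono fun m _ _ h => ?_) (cycleProb_or_le n _ _)
    rcases Nat.eq_zero_or_pos (m.countP q) with h0 | h0
    · exact Or.inl h0
    · right
      obtain ⟨p, hp, hqp⟩ := Multiset.countP_pos.1 h0
      unfold HasIsolatedPrime at h
      push Not at h
      obtain ⟨l, hl, hpl⟩ := h p hp (hq p hqp).1 (hq p hqp).2.2
      refine le_trans ?_ (Multiset.single_le_sum (fun x hx => ?_) _
        (Multiset.mem_map_of_mem _ hp))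
      · rw [if_pos hqp]
        have : 0 < (m.erase p).countP (p ∣ ·) := Multiset.countP_pos.2 ⟨l, hl, hpl⟩
        exact_mod_cast this
      · obtain ⟨p, -, rfl⟩ := Multiset.mem_map.1 hx
        split_ifs <;> positivity
  have h2 : cycleProb n (fun m => 1 ≤ D m) ≤ cycleMean n D := by
    refine cycleProb_le_cycleMean (fun m => Multiset.sum_nonneg fun x hx => ?_) fun m _ _ h => h
    obtain ⟨p, -, rfl⟩ := Multiset.mem_map.1 hx
    split_ifs <;> positivity
  have h3 : cycleMean n D ≤ (1 + Real.log n) / y := by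
    rw [hD, cycleMean_sum_erase n fun p m => if q p then ((m.countP (p ∣ ·) : ℕ) : ℝ) else 0]
    have hstep : ∀ p ∈ Icc 1 n, (p : ℝ)⁻¹ * cycleMean (n - p)
          (fun m => if q p then ((m.countP (p ∣ ·) : ℕ) : ℝ) else 0)
        ≤ if q p then ((p : ℝ) ^ 2)⁻¹ * (1 + Real.log n) else 0 := by
      intro p hp
      have hp1 := (Finset.mem_Icc.1 hp).1
      split_ifs with h
      · rw [cycleMean_countP]
        have := (invSum_mono (p ∣ ·) (Nat.sub_le n p)).trans (invSum_dvd_le hp1 n)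
        calc _ ≤ (p : ℝ)⁻¹ * ((p : ℝ)⁻¹ * (1 + Real.log n)) :=
              mul_le_mul_of_nonneg_left this (by positivity)
          _ = _ := by rw [pow_two, mul_inv, mul_assoc]
      · rw [cycleMean_const, mul_zero]
    refine (Finset.sum_le_sum hstep).trans ?_
    rw [← Finset.sum_filter, ← Finset.sum_mul, mul_comm, div_eq_mul_inv]
    refine mul_le_mul_of_nonneg_left ?_ (by linarith)
    have h4 := sum_Ioc_inv_sq_le_sub (α := ℝ) hy.ne' hyn
    have h5 : ∑ p ∈ Icc 1 n with q p, ((p : ℝ) ^ 2)⁻¹ ≤ ∑ p ∈ Ioc y n, ((p : ℝ) ^ 2)⁻¹ := by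
      refine Finset.sum_le_sum_of_subset_of_nonneg (fun j hj => ?_) fun _ _ _ => by positivity
      simp only [Finset.mem_filter, Finset.mem_Icc] at hj
      have := hq j hj.2
      rw [Finset.mem_Ioc]; omega
    have h6 : (0 : ℝ) ≤ (n : ℝ)⁻¹ := by positivity
    linarith
  have h4 := cycleProb_countP_eq_zero_le q n hs
  linarith

/-! ### Reciprocal sums of primes and existence of prime cycles -/

theorem mul_succ_le_two_pow {i : ℕ} (hi : 8 ≤ i) : 28 * (i + 1) ≤ 2 ^ i := by
  induction i, hi using Nat.le_induction with
  | base => norm_num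
  | succ i hi ih => rw [pow_succ]; omega

theorem sq_le_two_pow {i : ℕ} (hi : 8 ≤ i) : i ^ 2 ≤ 2 ^ i := by
  induction i, hi using Nat.le_induction with
  | base => norm_num
  | succ i hi ih => rw [pow_succ 2]; nlinarith

theorem log_four_bounds : 1.386 < Real.log 4 ∧ Real.log 4 < 1.387 := by
  have h : Real.log 4 = 2 * Real.log 2 := by
    rw [show (4 : ℝ) = 2 ^ 2 by norm_num, Real.log_pow]; norm_num
  have h1 := Real.log_two_gt_d9
  have h2 := Real.log_two_lt_d9
  constructor <;> linarith

/-- The available bounds for `θ(x)` are `x * log 4` above and about `x * log 2` below. On a range of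
ratio four they leave a main term `4 ^ i * log 4`, about `1.386 * 4 ^ i`; ratio two would leave
nothing. -/
theorem le_theta_sub_theta {i : ℕ} (hi : 8 ≤ i) :
    (4 : ℝ) ^ i ≤ Chebyshev.theta (4 ^ (i + 1)) - Chebyshev.theta (4 ^ i) := by
  obtain ⟨hl1, hl2⟩ := log_four_bounds
  have h1 := Chebyshev.theta_le_log4_mul_x (x := (4 : ℝ) ^ i) (by positivity)
  have h2 := Chebyshev.theta_ge (4 ^ (i + 1))
  push_cast at h2
  have hsq : √((4 : ℝ) ^ (i + 1)) = 2 ^ (i + 1) := by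
    rw [show (4 : ℝ) ^ (i + 1) = (2 ^ (i + 1)) ^ 2 by rw [← pow_mul, mul_comm, pow_mul]; norm_num]
    exact Real.sqrt_sq (by positivity)
  have hlog2 : Real.log 2 = Real.log 4 / 2 := by
    rw [show (4 : ℝ) = 2 ^ 2 by norm_num, Real.log_pow]; norm_num
  have h3 : Real.log ((4 : ℝ) ^ (i + 1) + 1) ≤ (i + 2) * Real.log 4 := by
    have : Real.log ((4 : ℝ) ^ (i + 1) + 1) ≤ Real.log ((4 : ℝ) ^ (i + 2)) := by
      refine Real.log_le_log (by positivity) ?_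
      have : (1 : ℝ) ≤ 4 ^ (i + 1) := one_le_pow₀ (by norm_num)
      rw [pow_succ _ (i + 1)]
      linarith
    rw [Real.log_pow] at this
    push_cast at this
    exact this
  rw [hsq, Real.log_pow, hlog2] at h2
  have hX : (2 : ℝ) ^ (i + 1) = 2 * 2 ^ i := by rw [pow_succ]; ring
  have hY : (4 : ℝ) ^ (i + 1) = 4 * 4 ^ i := by rw [pow_succ]; ring
  have hXY : (4 : ℝ) ^ i = 2 ^ i * 2 ^ i := by rw [← mul_pow]; norm_num
  rw [hX, hY] at h2
  rw [hY] at h3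
  push_cast at h2
  rw [hY]
  have hpow : (28 * (i + 1) : ℝ) ≤ 2 ^ i := by exact_mod_cast mul_succ_le_two_pow hi
  have hone : (1 : ℝ) ≤ 2 ^ i := one_le_pow₀ (by norm_num)
  set X : ℝ := 2 ^ i with hXdef
  set L := Real.log 4 with hL
  have hi0 : (0 : ℝ) ≤ i := Nat.cast_nonneg i
  -- The two error terms together take at most `0.3 * 4 ^ i` of the spare `0.386 * 4 ^ i`.
  have b1 : ((i : ℝ) + 2) * L ≤ 0.1 * (X * X) := by
    have : ((i : ℝ) + 2) * L ≤ 2 * (i + 1) * 1.387 := by nlinarith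
    nlinarith
  have b2 : 2 * (2 * X) * (((i : ℝ) + 1) * L) ≤ 0.2 * (X * X) := by
    have : ((i : ℝ) + 1) * L ≤ X / 28 * 1.387 := by nlinarith
    nlinarith
  rw [hXY] at h1 h2 h3 ⊢
  have hXX : 0 ≤ X * X := by positivity
  nlinarith

theorem sum_inv_prime_ge {i : ℕ} (hi : 8 ≤ i) :
    ((6 : ℝ) * (i + 1))⁻¹ ≤ ∑ p ∈ (Ioc (4 ^ i) (4 ^ (i + 1)) : Finset ℕ) with p.Prime, (p : ℝ)⁻¹ := by
  obtain ⟨hl1, hl2⟩ := log_four_bounds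
  have h1 := le_theta_sub_theta hi
  have h2 : Chebyshev.theta (4 ^ (i + 1)) - Chebyshev.theta (4 ^ i)
      = ∑ p ∈ (Ioc (4 ^ i) (4 ^ (i + 1)) : Finset ℕ) with p.Prime, Real.log p := by
    have e : ∀ k : ℕ, Chebyshev.theta ((4 : ℝ) ^ k) = 
        ∑ p ∈ (Ioc 0 (4 ^ k) : Finset ℕ) with p.Prime, Real.log p := by
      intro k
      rw [Chebyshev.theta, show ((4 : ℝ) ^ k) = ((4 ^ k : ℕ) : ℝ) by push_cast; rfl,
        Nat.floor_natCast]
    rw [e, e, sub_eq_iff_eq_add', Finset.sum_filter, Finset.sum_filter, Finset.sum_filter]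
    exact (Finset.sum_Ioc_consecutive (fun p : ℕ => if p.Prime then Real.log p else 0)
      (Nat.zero_le _) (Nat.pow_le_pow_right (n := 4) (by norm_num) (Nat.le_succ i))).symm
  have h3 : ∑ p ∈ (Ioc (4 ^ i) (4 ^ (i + 1)) : Finset ℕ) with p.Prime, Real.log p
      ≤ ∑ p ∈ (Ioc (4 ^ i) (4 ^ (i + 1)) : Finset ℕ) with p.Prime,
        (4 ^ (i + 1) * ((i + 1) * Real.log 4)) * (p : ℝ)⁻¹ := by
    refine Finset.sum_le_sum fun p hp => ?_
    simp only [Finset.mem_filter, Finset.mem_Ioc] at hp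
    have hp0 : (0 : ℝ) < p := by exact_mod_cast hp.2.pos
    have hple : (p : ℝ) ≤ 4 ^ (i + 1) := by exact_mod_cast hp.1.2
    have hlog : Real.log p ≤ (i + 1) * Real.log 4 := by
      have := Real.log_le_log hp0 hple
      rw [Real.log_pow] at this
      exact_mod_cast this
    rw [← div_eq_mul_inv, le_div_iff₀ hp0, mul_comm]
    exact mul_le_mul hple hlog (Real.log_nonneg (by exact_mod_cast hp.2.one_le)) (by positivity)
  rw [← Finset.mul_sum] at h3
  set S := ∑ p ∈ (Ioc (4 ^ i) (4 ^ (i + 1)) : Finset ℕ) with p.Prime, (p : ℝ)⁻¹ with hS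
  have hS0 : 0 ≤ S := Finset.sum_nonneg fun _ _ => by positivity
  have h4 : (4 : ℝ) ^ i * 1 ≤ 4 ^ i * (4 * ((i + 1) * Real.log 4) * S) := by
    rw [h2] at h1
    calc (4 : ℝ) ^ i * 1 ≤ 4 ^ (i + 1) * ((i + 1) * Real.log 4) * S := by linarith
      _ = _ := by rw [pow_succ]; ring
  have h5 : 1 ≤ 4 * (((i : ℝ) + 1) * Real.log 4) * S := le_of_mul_le_mul_left h4 (by positivity)
  rw [inv_le_iff_one_le_mul₀ (by positivity)]
  have h6 : 4 * Real.log 4 ≤ 6 := by linarith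
  have h7 : 0 ≤ S * ((i : ℝ) + 1) := by positivity
  nlinarith

/-- The block `(4 ^ i, 4 ^ (i + 1)]` contributes at least `1 / (6 * (i + 1))`; summing over `a ≤ i <
a ^ 2` gives a difference of harmonic numbers, of size `log (a ^ 2) - log a`. -/
theorem sum_inv_prime_sq_ge {a : ℕ} (ha : 8 ≤ a) :
    (Real.log a - 1) / 6 ≤ ∑ p ∈ (Ioc (4 ^ a) (4 ^ (a ^ 2)) : Finset ℕ) with p.Prime, (p : ℝ)⁻¹ := by
  have h1 : ∀ b, a ≤ b → ∑ i ∈ Ico a b, ((6 : ℝ) * (i + 1))⁻¹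
      ≤ ∑ p ∈ (Ioc (4 ^ a) (4 ^ b) : Finset ℕ) with p.Prime, (p : ℝ)⁻¹ := by
    intro b hb
    induction b, hb using Nat.le_induction with
    | base => simp
    | succ b hb ih =>
      rw [Finset.sum_Ico_succ_top hb]
      have h2 := sum_inv_prime_ge (ha.trans hb)
      rw [Finset.sum_filter] at ih h2 ⊢
      rw [← Finset.sum_Ioc_consecutive _ (Nat.pow_le_pow_right (by norm_num) hb)
        (Nat.pow_le_pow_right (by norm_num) (Nat.le_succ b))]
      linarith
  have hle : a ≤ a ^ 2 := by nlinarith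
  refine le_trans ?_ (h1 _ hle)
  have ha0 : (0 : ℝ) < a := by exact_mod_cast (show 0 < a by omega)
  have h3 : ∑ i ∈ Ico a (a ^ 2), ((6 : ℝ) * (i + 1))⁻¹
      = ((harmonic (a ^ 2) : ℝ) - harmonic a) / 6 := by
    unfold harmonic
    push_cast
    rw [← Finset.sum_range_add_sum_Ico _ hle, add_sub_cancel_left, Finset.sum_div]
    refine Finset.sum_congr rfl fun i _ => ?_
    rw [mul_inv]; ring
  rw [h3]
  have h4 := harmonic_le_one_add_log a
  have h5 := log_add_one_le_harmonic (a ^ 2)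
  have h6 : 2 * Real.log a ≤ Real.log ((a ^ 2 : ℕ) + 1 : ℝ) := by
    rw [← Nat.cast_ofNat (R := ℝ) (n := 2), ← Real.log_pow]
    refine Real.log_le_log (by positivity) ?_
    push_cast; linarith
  push_cast at h5 h6
  linarith

theorem exists_cycleProb_not_hasIsolatedPrime_lt {ε : ℝ} (hε : 0 < ε) :
    ∃ N : ℕ, ∀ n ≥ N, cycleProb n (fun m => ¬ HasIsolatedPrime n m) < ε := by
  obtain ⟨A, hA⟩ : ∃ A : ℕ, ∀ a ≥ A, 12 / ε < Real.log a - 1 ∧ 4 / ε < a ∧ 8 ≤ a := by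
    have h1 := (Real.tendsto_log_atTop.comp (tendsto_natCast_atTop_atTop (R := ℝ))).eventually_gt_atTop
      (12 / ε + 1)
    have h2 := (tendsto_natCast_atTop_atTop (R := ℝ)).eventually_gt_atTop (4 / ε)
    obtain ⟨A, hA⟩ := Filter.eventually_atTop.1
      (h1.and (h2.and (Filter.eventually_ge_atTop 8)))
    refine ⟨A, fun a ha => ?_⟩
    obtain ⟨h1, h2, h3⟩ := hA a ha
    exact ⟨by have : 12 / ε + 1 < Real.log a := h1
              linarith, h2, h3⟩
  refine ⟨2 * 4 ^ (A ^ 2), fun n hn => ?_⟩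
  -- This `a` puts `4 ^ (a ^ 2)` below `n / 2` while `log n` is only of order `a ^ 2`: the primes in
  -- `(4 ^ a, 4 ^ (a ^ 2)]` have unbounded reciprocal sum, and `4 ^ a` dominates `log n`.
  set a := Nat.sqrt (Nat.log 4 (n / 2)) with ha
  have hn2 : 4 ^ (A ^ 2) ≤ n / 2 := by omega
  have hAa : A ≤ a := by
    rw [ha, Nat.le_sqrt']
    exact Nat.le_log_of_pow_le (by norm_num) hn2
  obtain ⟨ha1, ha2, ha8⟩ := hA a hAa
  have hn2' : n / 2 ≠ 0 := by
    have : 0 < 4 ^ (A ^ 2) := by positivity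
    omega
  have hlow : 4 ^ (a ^ 2) ≤ n / 2 :=
    (Nat.pow_le_pow_right (by norm_num) (Nat.sqrt_le' _)).trans (Nat.pow_log_le_self 4 hn2')
  have hup : n / 2 < 4 ^ ((a + 1) ^ 2) := by
    refine (Nat.lt_pow_succ_log_self (b := 4) (by norm_num) (n / 2)).trans_le ?_
    exact Nat.pow_le_pow_right (by norm_num) (Nat.succ_le_of_lt (Nat.lt_succ_sqrt' _))
  have hnup : n ≤ 4 ^ ((a + 1) ^ 2 + 1) := by rw [pow_succ]; omega
  have hn0 : 0 < n := by omega
  have ha0 : (8 : ℝ) ≤ a := by exact_mod_cast ha8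
  have hlogn : Real.log n ≤ ((a + 1) ^ 2 + 1) * 1.387 := by
    have h1 : Real.log n ≤ Real.log ((4 : ℝ) ^ ((a + 1) ^ 2 + 1)) :=
      Real.log_le_log (by exact_mod_cast hn0) (by exact_mod_cast hnup)
    rw [Real.log_pow] at h1
    push_cast at h1
    have := log_four_bounds.2
    nlinarith [sq_nonneg ((a : ℝ) + 1)]
  set q : ℕ → Prop := fun p => p.Prime ∧ 4 ^ a < p ∧ p ≤ 4 ^ (a ^ 2) with hq
  have hsum : (Real.log a - 1) / 6 ≤ invSum q n := by
    refine (sum_inv_prime_sq_ge ha8).trans ?_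
    refine Finset.sum_le_sum_of_subset_of_nonneg (fun p hp => ?_) fun _ _ _ => by positivity
    simp only [Finset.mem_filter, Finset.mem_Ioc, Finset.mem_Icc] at hp ⊢
    exact ⟨⟨hp.2.one_le, by omega⟩, hp.2, hp.1⟩
  have hpos : 0 < 12 / ε := by positivity
  have hle : 4 ^ a ≤ n := by
    refine le_trans (Nat.pow_le_pow_right (by norm_num) (show a ≤ a ^ 2 by nlinarith)) ?_
    omega
  have key := cycleProb_not_hasIsolatedPrime_le (y := 4 ^ a) (by positivity) hle q
    (fun j hj => ⟨hj.1, hj.2.1, by have := hj.2.2; omega⟩) (by linarith)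
  refine key.trans_lt ?_
  have k1 : 1 / invSum q n < ε / 2 := by
    rw [div_lt_iff₀ (by linarith)]
    have : 2 / ε < invSum q n := by
      have : 12 / ε = 6 * (2 / ε) := by ring
      linarith
    rw [div_lt_iff₀ hε] at this
    linarith
  have k2 : (1 + Real.log n) / ((4 ^ a : ℕ) : ℝ) < ε / 2 := by
    have h28 : (28 * (a + 1) : ℝ) ≤ 2 ^ a := by exact_mod_cast mul_succ_le_two_pow ha8
    have h4 : ((4 ^ a : ℕ) : ℝ) = 2 ^ a * 2 ^ a := by
      push_cast; rw [← mul_pow]; norm_num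
    have h5 : (0 : ℝ) < 2 ^ a := by positivity
    rw [h4, div_lt_iff₀ (by positivity)]
    have h6 : 1 + Real.log n ≤ 2 * (a : ℝ) ^ 2 := by nlinarith
    rw [div_lt_iff₀ hε] at ha2
    have h7 : (a : ℝ) ^ 2 ≤ 2 ^ a := by exact_mod_cast sq_le_two_pow ha8
    have h8 : (28 * a : ℝ) * (a : ℝ) ^ 2 ≤ 2 ^ a * 2 ^ a :=
      mul_le_mul (by linarith) h7 (by positivity) h5.le
    have h9 : 4 * (a : ℝ) ^ 2 < (a * ε) * (a : ℝ) ^ 2 :=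
      mul_lt_mul_of_pos_right ha2 (by positivity)
    have h10 : ε / 2 * ((28 * a : ℝ) * (a : ℝ) ^ 2) ≤ ε / 2 * (2 ^ a * 2 ^ a) :=
      mul_le_mul_of_nonneg_left h8 (by positivity)
    nlinarith
  linarith

/-! ### Invariant sets, blocks and Jordan's theorem -/

section GroupTheory
open MulAction Equiv.Perm
open scoped Pointwise

variable {α : Type*} [Fintype α] [DecidableEq α]

theorem cycleParts_eq_of_isConj {σ τ : Equiv.Perm α} (h : IsConj σ τ) :
    cycleParts σ = cycleParts τ := by
  have h1 := isConj_iff_cycleType_eq.1 h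
  unfold cycleParts
  rw [← sum_cycleType, ← sum_cycleType, h1]

theorem hasSubsetSum_cycleParts_card {σ : Equiv.Perm α} {B : Finset α}
    (h : ∀ x, σ x ∈ B ↔ x ∈ B) : HasSubsetSum (cycleParts σ) #B := by
  set u := σ.subtypePerm (p := (· ∈ B)) h with hu
  have h' : ∀ x, σ x ∉ B ↔ x ∉ B := fun x => not_congr (h x)
  set v := σ.subtypePerm (p := (· ∉ B)) h' with hv
  have hdisj : (ofSubtype u).Disjoint (ofSubtype v) := by
    intro x
    by_cases hx : x ∈ B
    · exact Or.inr (ofSubtype_apply_of_not_mem v (by simpa using hx))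
    · exact Or.inl (ofSubtype_apply_of_not_mem u hx)
  have hmul : σ = ofSubtype u * ofSubtype v := by
    ext x
    rw [Equiv.Perm.mul_apply]
    by_cases hx : x ∈ B
    · rw [ofSubtype_apply_of_not_mem v (by simpa using hx), ofSubtype_apply_of_mem u hx]
      simp [hu]
    · rw [ofSubtype_apply_of_mem v hx, ofSubtype_apply_of_not_mem u]
      · simp [hv]
      · simpa [hv, h] using hx
  have hct : σ.cycleType = u.cycleType + v.cycleType := by
    conv_lhs => rw [hmul]
    rw [hdisj.cycleType_mul, cycleType_ofSubtype, cycleType_ofSubtype]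
  refine ⟨cycleParts u, ?_, by rw [sum_cycleParts]; simp⟩
  unfold cycleParts
  rw [hct]
  refine add_le_add (Multiset.le_add_right _ _) ?_
  rw [Multiset.replicate_le_replicate]
  have h1 : #σ.support = #u.support + #v.support := by
    rw [← sum_cycleType, hct, Multiset.sum_add, sum_cycleType, sum_cycleType]
  have h2 : #v.support ≤ Fintype.card {x // x ∉ B} := Finset.card_le_univ _
  have h3 : Fintype.card {x // x ∉ B} = Fintype.card α - Fintype.card {x // x ∈ B} :=
    Fintype.card_subtype_compl _
  have h4 : Fintype.card {x // x ∈ B} ≤ Fintype.card α := Fintype.card_subtype_le _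
  omega

/-- Raising to the product of the other nontrivial cycle lengths kills those cycles and, as `p` does
not divide that product, keeps the `p`-cycle. -/
theorem exists_pow_isCycle_of_hasIsolatedPrime {n : ℕ} {σ : Equiv.Perm α}
    (h : HasIsolatedPrime n (cycleParts σ)) :
    ∃ M : ℕ, (σ ^ M).IsCycle ∧ (#(σ ^ M).support).Prime ∧ 2 * #(σ ^ M).support ≤ n := by
  obtain ⟨p, hp, hprime, hpn, hdvd⟩ := h
  have hpct : p ∈ σ.cycleType := by
    rcases Multiset.mem_add.1 hp with h | h
    · exact h
    · exact absurd (Multiset.eq_of_mem_replicate h) hprime.one_lt.ne'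
  obtain ⟨c, ρ, hσ, hdisj, hc, hcard⟩ := mem_cycleType_iff.1 hpct
  have hct : σ.cycleType = p ::ₘ ρ.cycleType := by
    rw [hσ, hdisj.cycleType_mul, hc.cycleType, hcard]; rfl
  have hnot : ∀ l ∈ ρ.cycleType, ¬ p ∣ l := by
    intro l hl
    refine hdvd l ?_
    rw [cycleParts, hct, Multiset.cons_add, Multiset.erase_cons_head]
    exact Multiset.mem_add.2 (Or.inl hl)
  set M := ρ.cycleType.prod with hM
  have hρ : ρ ^ M = 1 := by
    rw [← orderOf_dvd_iff_pow_eq_one, ← lcm_cycleType]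
    exact Multiset.lcm_dvd.2 fun l hl => Multiset.dvd_prod hl
  have hpM : ¬ p ∣ M := fun hd => by
    obtain ⟨l, hl, hpl⟩ := hprime.prime.exists_mem_multiset_dvd hd
    exact hnot l hl hpl
  have hord : orderOf c = p := by rw [hc.orderOf, hcard]
  have hcop : M.Coprime (orderOf c) := by
    rw [hord]; exact ((Nat.Prime.coprime_iff_not_dvd hprime).2 hpM).symm
  have hpow : σ ^ M = c ^ M := by rw [hσ, hdisj.commute.mul_pow, hρ, mul_one]
  have hsup : #(σ ^ M).support = p := by rw [hpow, support_pow_coprime hcop, hcard]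
  exact ⟨M, by rw [hpow]; exact hc.pow_iff.2 hcop, by rwa [hsup], by rwa [hsup]⟩

/-- Translate the block so that it contains a point `x` moved by the prime cycle `t = s ^ M`, and
take a second point `y` in it. If `t` fixes `y`, then `t` preserves the block; otherwise `y = t ^ i
x`, so `t ^ i` preserves it, and so does `t`, a power of `t ^ i` by primality. The block thus
contains the support of `t`. As `s` commutes with `t`, `s x` is in that support, and the block meets
its image under `s`. -/
theorem exists_smul_block_eq {G : Subgroup (Equiv.Perm α)} [IsPretransitive G α] {B : Set α}
    (hB : IsBlock G B) (hnt : B.Nontrivial) (s : G) {M : ℕ}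
    (hcyc : ((s : Equiv.Perm α) ^ M).IsCycle) (hp : (#((s : Equiv.Perm α) ^ M).support).Prime) :
    ∃ g : G, s • (g • B) = g • B := by
  set t : G := s ^ M with ht
  have htc : (t : Equiv.Perm α).IsCycle := by simpa [ht] using hcyc
  have hord : (orderOf (t : Equiv.Perm α)).Prime := by rw [htc.orderOf]; simpa [ht] using hp
  obtain ⟨x, hx, -⟩ := id htc
  obtain ⟨y₀, hy₀, z₀, hz₀, hne⟩ := hnt
  obtain ⟨g, hg⟩ := MulAction.exists_smul_eq G y₀ x
  have hB' : IsBlock G (g • B) := hB.translate g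
  have hxB : x ∈ g • B := by rw [← hg]; exact Set.smul_mem_smul_set hy₀
  have hyB : g • z₀ ∈ g • B := Set.smul_mem_smul_set hz₀
  have hyx : g • z₀ ≠ x := by
    rw [← hg]; exact fun h => hne (smul_left_cancel g h).symm
  set y := g • z₀ with hy
  have htB : t ∈ stabilizer G (g • B) := by
    by_cases hty : (t : Equiv.Perm α) y = y
    · exact hB'.smul_eq_of_mem hyB (show t • y ∈ g • B by
        rw [show t • y = (t : Equiv.Perm α) y from rfl, hty]; exact hyB)
    · obtain ⟨i, hi⟩ := htc.exists_pow_eq hx hty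
      have hmem : t ^ i ∈ stabilizer G (g • B) := hB'.smul_eq_of_mem hxB (by
        rw [show (t ^ i) • x = ((t : Equiv.Perm α) ^ i) x from rfl, hi]; exact hyB)
      have hcop : i.Coprime (orderOf t) := by
        rw [← Subgroup.orderOf_coe]
        refine ((Nat.Prime.coprime_iff_not_dvd hord).2 fun hd => hyx ?_).symm
        rw [orderOf_dvd_iff_pow_eq_one.1 hd] at hi
        simpa using hi.symm
      obtain ⟨k, hk⟩ := exists_pow_eq_self_of_coprime hcop
      rw [← hk]
      exact Subgroup.pow_mem _ hmem k
  refine ⟨g, ?_⟩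
  have hcomm : (t : Equiv.Perm α) ((s : Equiv.Perm α) x) = (s : Equiv.Perm α) ((t : Equiv.Perm α) x) := by
    have : t * s = s * t := by rw [ht, ← pow_succ, ← pow_succ']
    have := congrArg (fun u : G => (u : Equiv.Perm α) x) this
    simpa using this
  have hsx : (t : Equiv.Perm α) ((s : Equiv.Perm α) x) ≠ (s : Equiv.Perm α) x := by
    rw [hcomm]; exact fun h => hx ((s : Equiv.Perm α).injective h)
  obtain ⟨i, hi⟩ := htc.exists_pow_eq hx hsx
  refine hB'.smul_eq_of_mem hxB ?_
  have hmem : t ^ i • (g • B) = g • B := Subgroup.pow_mem _ htB i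
  rw [← hmem]
  have : s • x = t ^ i • x := hi.symm
  rw [this]
  exact Set.smul_mem_smul_set hxB

/-- On the support of `σ` the permutation `τ` agrees with the transposition of `x` and `τ x`, so
both conjugate `σ` identically. The commutator becomes a product of two transpositions sharing `τ
x`. -/
theorem isThreeCycle_commutator {σ τ : Equiv.Perm α} {x : α}
    (hx : σ.support ∩ τ.support = {x}) : (σ * τ * σ⁻¹ * τ⁻¹).IsThreeCycle := by
  have hxm : x ∈ σ.support ∩ τ.support := by rw [hx]; simp
  obtain ⟨hxσ, hxτ⟩ := Finset.mem_inter.1 hxm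
  have huniq : ∀ u, u ∈ σ.support → u ∈ τ.support → u = x := fun u h1 h2 => by
    have : u ∈ σ.support ∩ τ.support := Finset.mem_inter.2 ⟨h1, h2⟩
    rwa [hx, Finset.mem_singleton] at this
  set b := τ x with hb
  have hbx : b ≠ x := mem_support.1 hxτ
  have hbτ : b ∈ τ.support := apply_mem_support.2 hxτ
  have hbσ : b ∉ σ.support := fun h => hbx (huniq b h hbτ)
  have haσ : σ x ∈ σ.support := apply_mem_support.2 hxσ
  have hσb : σ b = b := notMem_support.1 hbσ
  set s := Equiv.swap x b with hs
  have hdisj : (s⁻¹ * τ).Disjoint σ := by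
    intro u
    by_cases hu : u ∈ σ.support
    · left
      rw [Equiv.Perm.mul_apply, Equiv.Perm.inv_eq_iff_eq]
      by_cases hux : u = x
      · rw [hux, hs, Equiv.swap_apply_left]
      · have : u ∉ τ.support := fun h => hux (huniq u hu h)
        rw [notMem_support.1 this, hs, Equiv.swap_apply_of_ne_of_ne hux]
        rintro rfl; exact hbσ hu
    · exact Or.inr (notMem_support.1 hu)
  have hcomm : τ * σ * τ⁻¹ = s * σ * s⁻¹ := by
    have h1 := hdisj.commute.eq
    calc τ * σ * τ⁻¹ = s * (s⁻¹ * τ * σ) * τ⁻¹ := by group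
      _ = s * (σ * (s⁻¹ * τ)) * τ⁻¹ := by rw [h1]
      _ = s * σ * s⁻¹ := by group
  have hmain : σ * τ * σ⁻¹ * τ⁻¹ = Equiv.swap b (σ x) * Equiv.swap b x := by
    have h2 : σ * s * σ⁻¹ = Equiv.swap (σ x) b := by
      rw [hs, ← Equiv.swap_apply_apply, hσb]
    calc σ * τ * σ⁻¹ * τ⁻¹ = σ * (τ * σ * τ⁻¹)⁻¹ := by group
      _ = σ * (s * σ * s⁻¹)⁻¹ := by rw [hcomm]
      _ = (σ * s * σ⁻¹) * s⁻¹ := by group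
      _ = _ := by rw [h2, hs, Equiv.swap_inv, Equiv.swap_comm x b, Equiv.swap_comm (σ x) b]
  rw [hmain]
  refine isThreeCycle_swap_mul_swap_same (fun h => hbσ (h ▸ haσ)) hbx (mem_support.1 hxσ)

/-- Jordan's theorem makes `G` `(n - p + 1)`-fold transitive, where `n` is the degree, hence
`p`-fold transitive since `2 * p ≤ n`. Some conjugate of `τ` then has support meeting that of `τ` in
one point, and the commutator is a 3-cycle. -/
theorem alternatingGroup_le_of_isPreprimitive_of_prime_isCycle_mem {G : Subgroup (Equiv.Perm α)}
    (hG : IsPreprimitive G α) {τ : Equiv.Perm α} (hτ : τ ∈ G) (hcyc : τ.IsCycle)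
    (hp : (#τ.support).Prime) (hcard : 2 * #τ.support ≤ Fintype.card α) :
    alternatingGroup α ≤ G := by
  set p := #τ.support with hpdef
  have hp2 := hp.two_le
  obtain ⟨k, hk⟩ : ∃ k, Fintype.card α = p + (k + 1) :=
    ⟨Fintype.card α - p - 1, by omega⟩
  have hncard : ((τ.support : Set α)ᶜ).ncard = k + 1 := by
    apply Nat.add_left_cancel (n := p)
    rw [← hk, ← Nat.card_eq_fintype_card, ← Set.ncard_add_ncard_compl (τ.support : Set α),
      Set.ncard_coe_finset]
  have htrans := isPretransitive_of_isCycle_mem hcyc hτ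
  have hprim : IsPreprimitive (fixingSubgroup G (τ.support : Set α)ᶜ)
      (SubMulAction.ofFixingSubgroup G (τ.support : Set α)ᶜ) := by
    apply IsPreprimitive.of_prime_card
    have hset : {x | x ∈ SubMulAction.ofFixingSubgroup G (τ.support : Set α)ᶜ}
        = (τ.support : Set α) := by
      ext x; simp [SubMulAction.mem_ofFixingSubgroup_iff]
    have hc : Nat.card (SubMulAction.ofFixingSubgroup G (τ.support : Set α)ᶜ) = p := by
      have h1 := congrArg Set.ncard hset
      rw [Set.ncard_coe_finset] at h1
      exact h1
    rwa [hc]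
  have hmp : IsMultiplyPreprimitive G α (k + 2) :=
    hG.isMultiplyPreprimitive hncard (by rw [Nat.card_eq_fintype_card]; omega) hprim
  have hmt : IsMultiplyPretransitive G α (k + 2) := hmp.isMultiplyPretransitive
  have hpt : IsMultiplyPretransitive G α p :=
    isMultiplyPretransitive_of_le (n := k + 2) (by omega)
      (by rw [Nat.card_eq_fintype_card]; omega)
  obtain ⟨x, hx⟩ : τ.support.Nonempty := Finset.card_pos.1 (by omega)
  -- `insert x D` is the support wanted for the conjugate; `2 * p ≤ n` leaves room for `D` outside
  -- the support of `τ`.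
  obtain ⟨D, hD, hDcard⟩ : ∃ D ⊆ τ.supportᶜ, #D = p - 1 :=
    Finset.exists_subset_card_eq (by rw [Finset.card_compl]; omega)
  have hxD : x ∉ D := fun h => (Finset.mem_compl.1 (hD h)) hx
  have hCcard : #(insert x D) = p := by rw [Finset.card_insert_of_notMem hxD, hDcard]; omega
  let e : Fin p ↪ α := (Fintype.equivFinOfCardEq (α := τ.support)
    (Fintype.card_coe _)).symm.toEmbedding.trans (Function.Embedding.subtype _)
  let e' : Fin p ↪ α := (Fintype.equivFinOfCardEq (α := (insert x D : Finset α))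
    (by rw [Fintype.card_coe, hCcard])).symm.toEmbedding.trans (Function.Embedding.subtype _)
  obtain ⟨g, hg⟩ := isMultiplyPretransitive_iff.1 hpt e e'
  have hmap : τ.support.map (g : Equiv.Perm α).toEmbedding = insert x D := by
    refine Finset.eq_of_subset_of_card_le (fun y hy => ?_) ?_
    · obtain ⟨z, hz, rfl⟩ := Finset.mem_map.1 hy
      obtain ⟨i, hi⟩ : ∃ i, e i = z :=
        ⟨Fintype.equivFinOfCardEq (α := τ.support) (Fintype.card_coe _) ⟨z, hz⟩, by simp [e]⟩
      have h2 : (g : Equiv.Perm α) z = e' i := by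
        rw [← hi, ← hg]; rfl
      rw [Equiv.coe_toEmbedding, h2]
      exact Subtype.property _
    · rw [Finset.card_map, hCcard]
  have hinter : τ.support ∩ ((g : Equiv.Perm α) * τ * (g : Equiv.Perm α)⁻¹).support = {x} := by
    rw [support_conj, hmap]
    ext y
    simp only [Finset.mem_inter, Finset.mem_insert, Finset.mem_singleton]
    constructor
    · rintro ⟨h1, h2 | h2⟩
      · exact h2
      · exact absurd h1 (Finset.mem_compl.1 (hD h2))
    · rintro rfl; exact ⟨hx, Or.inl rfl⟩
  have hmem : (g : Equiv.Perm α) * τ * (g : Equiv.Perm α)⁻¹ ∈ G :=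
    G.mul_mem (G.mul_mem g.2 hτ) (G.inv_mem g.2)
  exact alternatingGroup_le_of_isPreprimitive_of_isThreeCycle_mem hG
    (isThreeCycle_commutator hinter)
    (G.mul_mem (G.mul_mem (G.mul_mem hτ hmem) (G.inv_mem hτ)) (G.inv_mem hmem))

theorem eq_top_of_alternatingGroup_le {G : Subgroup (Equiv.Perm α)} (hG : alternatingGroup α ≤ G)
    {τ : Equiv.Perm α} (hτ : τ ∈ G) (hsign : sign τ = -1) : G = ⊤ := by
  refine (Subgroup.eq_top_iff' G).2 fun g => ?_
  rcases Int.units_eq_one_or (sign g) with h | h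
  · exact hG (mem_alternatingGroup.2 h)
  · have h1 : g * τ⁻¹ ∈ G := hG (mem_alternatingGroup.2 (by simp [h, hsign]))
    simpa using G.mul_mem h1 hτ

theorem sign_eq_neg_one_of_odd {σ : Equiv.Perm α}
    (h : Odd ((cycleParts σ).sum + Multiset.card (cycleParts σ))) : sign σ = -1 := by
  rw [sign_of_cycleType]
  refine Odd.neg_one_pow ?_
  unfold cycleParts at h
  rw [Multiset.sum_add, Multiset.card_add, Multiset.sum_replicate, Multiset.card_replicate,
    smul_eq_mul, mul_one] at h
  rw [Nat.odd_iff] at h ⊢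
  omega

/-- For an orbit or block of size `k`, `hsum` selects a generator without invariant sets of size
`k`. An orbit is invariant under it, and so is a translate of a nontrivial block, by its prime
cycle; hence neither can be proper. -/
theorem invariablyGenerates_of_cycleParts {ι : Type*} {π : ι → Equiv.Perm α}
    (hsum : ∀ k, 0 < k → k < Fintype.card α → ∃ i, ¬ HasSubsetSum (cycleParts (π i)) k)
    (hprime : ∀ i, HasIsolatedPrime (Fintype.card α) (cycleParts (π i)))
    (hodd : ∃ i, Odd ((cycleParts (π i)).sum + Multiset.card (cycleParts (π i)))) :
    InvariablyGenerates π := by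
  intro g' hconj
  have hparts : ∀ i, cycleParts (π i) = cycleParts (g' i) := fun i =>
    cycleParts_eq_of_isConj (hconj i)
  simp_rw [hparts] at hsum hprime hodd
  set G := Subgroup.closure (Set.range g') with hG
  have hmem : ∀ i, g' i ∈ G := fun i => Subgroup.subset_closure ⟨i, rfl⟩
  have hcardB : ∀ B : Set α, B.Nonempty → B ≠ Set.univ →
      ∃ i, ¬ HasSubsetSum (cycleParts (g' i)) B.ncard := by
    intro B h1 h2
    refine hsum _ ((Set.ncard_pos).2 h1) ?_
    rw [← Nat.card_eq_fintype_card]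
    exact Set.ncard_lt_card h2
  have hinv : ∀ (B : Set α) (i : ι), (⟨g' i, hmem i⟩ : G) • B = B →
      HasSubsetSum (cycleParts (g' i)) B.ncard := by
    classical
    intro B i hB
    rw [Set.ncard_eq_toFinset_card' B]
    refine hasSubsetSum_cycleParts_card fun x => ?_
    rw [Set.mem_toFinset, Set.mem_toFinset]
    have : (⟨g' i, hmem i⟩ : G) • x ∈ (⟨g' i, hmem i⟩ : G) • B ↔ x ∈ B :=
      Set.smul_mem_smul_set_iff
    rw [hB] at this
    exact this
  have htrans : IsPretransitive G α := by
    refine ⟨fun x y => ?_⟩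
    by_contra hxy
    obtain ⟨i, hi⟩ := hcardB (orbit G x) ⟨x, mem_orbit_self x⟩ fun h => hxy (by
      have : y ∈ orbit G x := by rw [h]; trivial
      exact this)
    exact hi (hinv _ i (smul_orbit _ x))
  have hprim : IsPreprimitive G α := by
    refine ⟨fun {B} hB => ?_⟩
    by_contra hcon
    rw [IsTrivialBlock, not_or, Set.not_subsingleton_iff] at hcon
    obtain ⟨hnt, huniv⟩ := hcon
    obtain ⟨i, hi⟩ := hcardB B hnt.nonempty huniv
    obtain ⟨M, hM, hMp, -⟩ := exists_pow_isCycle_of_hasIsolatedPrime (hprime i)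
    obtain ⟨g, hg⟩ := exists_smul_block_eq hB hnt ⟨g' i, hmem i⟩ hM hMp
    have := hinv _ i hg
    rw [Set.ncard_smul_set] at this
    exact hi this
  obtain ⟨i, hi⟩ := hodd
  obtain ⟨M, hM, hMp, hMn⟩ := exists_pow_isCycle_of_hasIsolatedPrime (hprime i)
  exact eq_top_of_alternatingGroup_le
    (alternatingGroup_le_of_isPreprimitive_of_prime_isCycle_mem hprim
      (G.pow_mem (hmem i) M) hM hMp hMn) (hmem i) (sign_eq_neg_one_of_odd hi)

end GroupTheory

/-! ### Small degrees -/

section SmallDegree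
open MulAction Equiv.Perm
open scoped Pointwise

theorem sameCycle_finRotate (n : ℕ) (x y : Fin (n + 1)) :
    (finRotate (n + 1)).SameCycle x y := by
  have key : ∀ y, (finRotate (n + 1)).SameCycle 0 y := by
    intro y
    induction y using Fin.induction with
    | zero => exact SameCycle.refl _ _
    | succ i ih =>
      rw [← Fin.coeSucc_eq_succ, ← finRotate_apply]
      exact sameCycle_apply_right.2 ih
  exact (key x).symm.trans (key y)

/-- A group containing a transitive cycle, a cycle moving all points but one, and a transposition
is the symmetric group. -/
theorem eq_top_of_cycles_mem {α : Type*} [Finite α] [DecidableEq α] {G : Subgroup (Equiv.Perm α)}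
    {σ τ ρ : Equiv.Perm α} (hσ : σ ∈ G) (hτ : τ ∈ G) (hρ : ρ ∈ G)
    (hσc : ∀ x y, σ.SameCycle x y)
    (hτc : ∃ a, τ a = a ∧ ∀ x y, x ≠ a → y ≠ a → τ.SameCycle x y) (hρs : ρ.IsSwap) : G = ⊤ := by
  have htrans : IsPretransitive G α := ⟨fun x y => by
    obtain ⟨i, hi⟩ := hσc x y
    exact ⟨⟨σ, hσ⟩ ^ i, hi⟩⟩
  obtain ⟨a, ha, hτc⟩ := hτc
  have hprim : IsPreprimitive G α := by
    refine ⟨fun {B} hB => ?_⟩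
    rw [IsTrivialBlock, or_iff_not_imp_left, Set.not_subsingleton_iff]
    rintro ⟨y₀, hy₀, z₀, hz₀, hne⟩
    obtain ⟨g, hg⟩ := MulAction.exists_smul_eq G y₀ a
    have hB' : IsBlock G (g • B) := hB.translate g
    have haB : a ∈ g • B := hg ▸ Set.smul_mem_smul_set hy₀
    have hzB : g • z₀ ∈ g • B := Set.smul_mem_smul_set hz₀
    have hza : g • z₀ ≠ a := by rw [← hg]; exact fun h => hne (smul_left_cancel g h).symm
    set t : G := ⟨τ, hτ⟩
    have ht : t ∈ stabilizer G (g • B) := hB'.smul_eq_of_mem haB (by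
      rw [show t • a = τ a from rfl, ha]; exact haB)
    have huniv : g • B = Set.univ := by
      refine Set.eq_univ_of_forall fun y => ?_
      by_cases hy : y = a
      · rw [hy]; exact haB
      · obtain ⟨i, hi⟩ := hτc _ _ hza hy
        have h1 : t ^ i • (g • B) = g • B := Subgroup.zpow_mem _ ht i
        rw [← h1, ← hi]
        exact Set.smul_mem_smul_set hzB
    rw [← inv_smul_smul g B, huniv, Set.smul_set_univ]
  exact subgroup_eq_top_of_isPreprimitive_of_isSwap_mem hprim ρ hρs hρ

/-- An `n`-cycle, an `(n - 1)`-cycle and a transposition: the first gives transitivity, the second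
makes a point stabilizer transitive on the rest, and a primitive group with a transposition is
symmetric. The fourth entry is padding. -/
theorem exists_invariablyGenerates (n : ℕ) :
    ∃ π : Fin 4 → Equiv.Perm (Fin n), InvariablyGenerates π := by
  rcases Nat.lt_or_ge n 2 with hn | hn
  · refine ⟨fun _ => 1, fun g' _ => (Subgroup.eq_top_iff' _).2 fun g => ?_⟩
    have : Subsingleton (Fin n) := Fin.subsingleton_iff_le_one.2 (by omega)
    rw [Subsingleton.elim g 1]
    exact Subgroup.one_mem _
  obtain ⟨m, rfl⟩ := Nat.exists_eq_add_of_le' hn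
  set τ : Equiv.Perm (Fin (m + 2)) := decomposeFin.symm (0, finRotate (m + 1)) with hτ
  have hτsucc : ∀ x, τ (Fin.succ x) = (finRotate (m + 1) x).succ := fun x => by
    rw [hτ, decomposeFin_symm_apply_succ, Equiv.swap_self, Equiv.refl_apply]
  have hτc : ∃ a, τ a = a ∧ ∀ x y, x ≠ a → y ≠ a → τ.SameCycle x y := by
    refine ⟨0, by rw [hτ, decomposeFin_symm_apply_zero], fun x y hx hy => ?_⟩
    obtain ⟨x, rfl⟩ := Fin.exists_succ_eq.2 hx
    obtain ⟨y, rfl⟩ := Fin.exists_succ_eq.2 hy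
    obtain ⟨i, -, hi⟩ := (sameCycle_finRotate m x y).exists_pow_eq'
    refine ⟨i, ?_⟩
    have key : ∀ j : ℕ, (τ ^ j) x.succ = (((finRotate (m + 1)) ^ j) x).succ := by
      intro j
      induction j with
      | zero => rfl
      | succ j ih =>
        rw [pow_succ', Equiv.Perm.mul_apply, ih, hτsucc, pow_succ', Equiv.Perm.mul_apply]
    rw [zpow_natCast, key, hi]
  refine ⟨![finRotate (m + 2), τ, Equiv.swap 0 1, 1], fun g' hconj => ?_⟩
  have hmem : ∀ i, g' i ∈ Subgroup.closure (Set.range g') := fun i =>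
    Subgroup.subset_closure ⟨i, rfl⟩
  obtain ⟨u, hu⟩ := isConj_iff.1 (hconj 0)
  obtain ⟨v, hv⟩ := isConj_iff.1 (hconj 1)
  obtain ⟨w, hw⟩ := isConj_iff.1 (hconj 2)
  refine eq_top_of_cycles_mem (hmem 0) (hmem 1) (hmem 2) (fun x y => ?_) ?_ ?_
  · rw [← hu]
    exact sameCycle_conj.2 (sameCycle_finRotate (m + 1) _ _)
  · obtain ⟨a, ha, hc⟩ := hτc
    rw [← hv]
    refine ⟨v a, by simp [ha], fun x y hx hy => sameCycle_conj.2 (hc _ _ ?_ ?_)⟩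
    · exact fun h => hx (by rw [← h]; simp)
    · exact fun h => hy (by rw [← h]; simp)
  · rw [← hw]
    refine ⟨w 0, w 1, fun h => ?_, ?_⟩
    · exact absurd (w.injective h) (by simp)
    · exact (Equiv.swap_apply_apply w 0 1).symm

end SmallDegree

/-! ### The main theorem -/

theorem HasSubsetSum.compl {n : ℕ} {m : Multiset ℕ} (hm : m.sum = n) {k : ℕ}
    (h : HasSubsetSum m k) : HasSubsetSum m (n - k) := by
  obtain ⟨s, hs, rfl⟩ := h
  refine ⟨m - s, Multiset.sub_le_self _ _, ?_⟩
  have : (m - s).sum + s.sum = n := by rw [← Multiset.sum_add, tsub_add_cancel_of_le hs, hm]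
  omega

/-- Sums up to `K` are impossible in `d`, whose parts all exceed `K`; sums above `n / 2` reduce to
smaller ones by complementation. -/
theorem not_hasSubsetSum_of_noCommonSum {n K : ℕ} {a b c d : Multiset ℕ}
    (ha : a.sum = n) (hb : b.sum = n) (hc : c.sum = n) (hd : d.sum = n)
    (h : NoCommonSum n K a b c d) (hshort : ∀ l ∈ d, K < l) {k : ℕ} (hk : 0 < k) (hkn : k < n) :
    ¬ (HasSubsetSum a k ∧ HasSubsetSum b k ∧ HasSubsetSum c k ∧ HasSubsetSum d k) := by
  have key : ∀ k, 0 < k → 2 * k ≤ n →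
      ¬ (HasSubsetSum a k ∧ HasSubsetSum b k ∧ HasSubsetSum c k ∧ HasSubsetSum d k) := by
    intro k hk hkn hcom
    rcases Nat.lt_or_ge K k with hKk | hKk
    · exact h k hKk hkn hcom
    · obtain ⟨s, hs, rfl⟩ := hcom.2.2.2
      obtain ⟨l, hl⟩ := Multiset.exists_mem_of_ne_zero (s := s) (by rintro rfl; simp at hk)
      have h1 := hshort l (Multiset.mem_of_le hs hl)
      have h2 := Multiset.le_sum_of_mem hl
      omega
  intro ⟨h1, h2, h3, h4⟩
  rcases Nat.lt_or_ge n (2 * k) with h5 | h5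
  · exact key (n - k) (by omega) (by omega)
      ⟨HasSubsetSum.compl ha h1, HasSubsetSum.compl hb h2,
        HasSubsetSum.compl hc h3, HasSubsetSum.compl hd h4⟩
  · exact key k hk h5 ⟨h1, h2, h3, h4⟩

theorem uniformProb_eq_cycleProb₄ (n : ℕ)
    (Q : Multiset ℕ → Multiset ℕ → Multiset ℕ → Multiset ℕ → Prop) :
    uniformProb {π : Fin 4 → Equiv.Perm (Fin n) |
        Q (cycleParts (π 0)) (cycleParts (π 1)) (cycleParts (π 2)) (cycleParts (π 3))}
      = cycleProb₄ n Q := by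
  classical
  have hf : (n.factorial : ℝ) ≠ 0 := by exact_mod_cast n.factorial_ne_zero
  let e : (Fin 4 → Equiv.Perm (Fin n)) ≃
      Equiv.Perm (Fin n) × Equiv.Perm (Fin n) × Equiv.Perm (Fin n) × Equiv.Perm (Fin n) :=
    { toFun := fun π => (π 0, π 1, π 2, π 3)
      invFun := fun x => ![x.1, x.2.1, x.2.2.1, x.2.2.2]
      left_inv := fun π => by ext i : 1; fin_cases i <;> rfl
      right_inv := fun x => rfl }
  have hcard : (Nat.card {π : Fin 4 → Equiv.Perm (Fin n) |
        Q (cycleParts (π 0)) (cycleParts (π 1)) (cycleParts (π 2)) (cycleParts (π 3))} : ℝ)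
      = ∑ π : Fin 4 → Equiv.Perm (Fin n),
        if Q (cycleParts (π 0)) (cycleParts (π 1)) (cycleParts (π 2)) (cycleParts (π 3))
          then (1 : ℝ) else 0 := by
    rw [Finset.sum_boole, Nat.card_coe_set_eq, Set.ncard_eq_toFinset_card',
      Set.toFinset_ofPred]
  rw [uniformProb, hcard]
  have hsum : ∑ π : Fin 4 → Equiv.Perm (Fin n),
        (if Q (cycleParts (π 0)) (cycleParts (π 1)) (cycleParts (π 2)) (cycleParts (π 3))
          then (1 : ℝ) else 0)
      = ∑ x : Equiv.Perm (Fin n) × Equiv.Perm (Fin n) × Equiv.Perm (Fin n) × Equiv.Perm (Fin n),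
        if Q (cycleParts x.1) (cycleParts x.2.1) (cycleParts x.2.2.1) (cycleParts x.2.2.2)
          then (1 : ℝ) else 0 :=
    Fintype.sum_equiv e _ _ fun π => rfl
  rw [hsum]
  simp_rw [Fintype.sum_prod_type]
  have s1 : ∀ a b c, ∑ σ : Equiv.Perm (Fin n), (if Q a b c (cycleParts σ) then (1 : ℝ) else 0)
      = n.factorial * cycleProb n (Q a b c) := fun a b c => by
    rw [sum_perm_eq_cycleMean n fun d => if Q a b c d then (1 : ℝ) else 0, cycleProb]
  have s2 : ∀ a b, ∑ σ : Equiv.Perm (Fin n), cycleProb n (Q a b (cycleParts σ))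
      = n.factorial * cycleMean n fun c => cycleProb n (Q a b c) := fun a b =>
    sum_perm_eq_cycleMean n fun c => cycleProb n (Q a b c)
  have s3 : ∀ a, ∑ σ : Equiv.Perm (Fin n), cycleMean n (fun c => cycleProb n (Q a (cycleParts σ) c))
      = n.factorial * cycleMean n fun b => cycleMean n fun c => cycleProb n (Q a b c) := fun a =>
    sum_perm_eq_cycleMean n fun b => cycleMean n fun c => cycleProb n (Q a b c)
  have s4 := sum_perm_eq_cycleMean n fun a =>
    cycleMean n fun b => cycleMean n fun c => cycleProb n (Q a b c)
  simp_rw [s1, ← Finset.mul_sum, s2, ← Finset.mul_sum, s3, ← Finset.mul_sum, s4]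
  rw [Nat.card_eq_fintype_card, Fintype.card_fun, Fintype.card_perm, Fintype.card_fin,
    Fintype.card_fin, cycleProb₄]
  push_cast
  field_simp

theorem uniformProb_mono {Ω : Type*} [Finite Ω] {E F : Set Ω} (h : E ⊆ F) :
    uniformProb E ≤ uniformProb F :=
  div_le_div_of_nonneg_right (by exact_mod_cast Nat.card_mono (Set.toFinite F) h)
    (Nat.cast_nonneg _)

theorem uniformProb_pos {Ω : Type*} [Finite Ω] {E : Set Ω} (h : E.Nonempty) :
    0 < uniformProb E := by
  have : Nonempty E := h.to_subtype
  have : Nonempty Ω := ⟨h.some⟩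
  exact div_pos (by exact_mod_cast Nat.card_pos) (by exact_mod_cast Nat.card_pos)

/-- The good event on sums and sign has probability at least `c`, while the four failures of the
prime condition cost at most `4 * (c / 8)`, leaving `c / 2`. -/
theorem exists_le_uniformProb_of_large : ∃ (N : ℕ) (c : ℝ), 0 < c ∧ ∀ n ≥ N,
    c ≤ uniformProb {π : Fin 4 → Equiv.Perm (Fin n) | InvariablyGenerates π} := by
  obtain ⟨K, c, hc, hK⟩ := exists_le_cycleProb₄
  obtain ⟨N, hN⟩ := exists_cycleProb_not_hasIsolatedPrime_lt (show 0 < c / 8 by positivity)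
  refine ⟨max N (2 * K), c / 2, by positivity, fun n hn => ?_⟩
  have h1 := hK n ((le_max_right _ _).trans hn)
  have h2 := hN n ((le_max_left _ _).trans hn)
  set Bad : Multiset ℕ → Prop := fun m => ¬ HasIsolatedPrime n m with hBad
  set Good : Multiset ℕ → Multiset ℕ → Multiset ℕ → Multiset ℕ → Prop := fun a b c d =>
    (NoCommonSum n K a b c d ∧ (∀ l ∈ d, K < l) ∧ Odd (c.sum + Multiset.card c)) ∧
      HasIsolatedPrime n a ∧ HasIsolatedPrime n b ∧ HasIsolatedPrime n c ∧ HasIsolatedPrime n d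
    with hGood
  have h3 : cycleProb₄ n (fun a b c d => NoCommonSum n K a b c d ∧ (∀ l ∈ d, K < l) ∧
      Odd (c.sum + Multiset.card c)) ≤ cycleProb₄ n Good + 4 * cycleProb n Bad := by
    refine le_trans (cycleProb₄_mono fun a b c d _ _ _ _ h => ?_)
      (cycleProb₄_or_le.trans (add_le_add_right (cycleProb₄_coords Bad) _))
    by_cases hb : Bad a ∨ Bad b ∨ Bad c ∨ Bad d
    · exact Or.inr hb
    · left
      simp only [hBad, not_or, not_not] at hb
      exact ⟨h, hb⟩
  have h4 : cycleProb₄ n Good ≤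
      uniformProb {π : Fin 4 → Equiv.Perm (Fin n) | InvariablyGenerates π} := by
    rw [← uniformProb_eq_cycleProb₄]
    refine uniformProb_mono fun π hπ => ?_
    obtain ⟨⟨hno, hshort, hodd⟩, hp0, hp1, hp2, hp3⟩ := hπ
    have hs : ∀ i, (cycleParts (π i)).sum = n := fun i => by simpa using sum_cycleParts (π i)
    refine invariablyGenerates_of_cycleParts (fun k hk hkn => ?_) (fun i => ?_) ⟨2, hodd⟩
    · rw [Fintype.card_fin] at hkn
      by_contra hcon
      push Not at hcon
      exact not_hasSubsetSum_of_noCommonSum (hs 0) (hs 1) (hs 2) (hs 3) hno hshort hk hkn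
        ⟨hcon 0, hcon 1, hcon 2, hcon 3⟩
    · rw [Fintype.card_fin]
      fin_cases i
      · exact hp0
      · exact hp1
      · exact hp2
      · exact hp3
  linarith

theorem theorem1p1 :
    ∃ c : ℝ, 0 < c ∧ ∀ n : ℕ,
      c ≤ uniformProb {π : Fin 4 → Equiv.Perm (Fin n) | InvariablyGenerates π} := by
  obtain ⟨N, c, hc, hN⟩ := exists_le_uniformProb_of_large
  set f : ℕ → ℝ := fun n => uniformProb {π : Fin 4 → Equiv.Perm (Fin n) | InvariablyGenerates π}
    with hf
  have hpos : ∀ n, 0 < f n := fun n => uniformProb_pos (exists_invariablyGenerates n)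
  -- Only `n < N` matters; `N + 1` keeps the range nonempty.
  obtain ⟨m, -, hm⟩ := Finset.exists_min_image (range (N + 1)) f ⟨0, by simp⟩
  refine ⟨min c (f m), lt_min hc (hpos m), fun n => ?_⟩
  rcases Nat.lt_or_ge n N with h | h
  · exact (min_le_right _ _).trans (hm n (Finset.mem_range.2 (by omega)))
  · exact (min_le_left _ _).trans (hN n h)
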